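/- **Setting.** Let $d,S\ge 1$, $\mathcal X=[S]^d$, and let $q_0$ be a probability mass function on $\mathcal X$. Put $R_{\rm base}=\frac1S\mathbf 1\mathbf 1^{\top}-I_S$, and let $R$ be the rate matrix on $\mathcal X$ with $R(x,y)=R_{\rm base}(x^i,y^i)$ if $x,y$ differ exactly in coordinate $i$, $R(x,y)=0$ if they differ in at least two coordinates, and $R(x,x)=-\sum_{y\ne x}R(x,y)$. Let $q_t=q_0e^{tR}$ be the law at time $t$ of the continuous-time Markov chain with rate $R$ and initial law $q_0$. Fix $0<\delta<T$ and points $0=t_0<t_1<\dots<t_N=T-\delta$; write $h_k=t_{k+1}-t_k$. Let $s_{T-t_k}(y,x)$ be estimates of $q_{T-t_k}(y)/q_{T-t_k}(x)$, and let $$\mathcal L_{SE}(t;s)=\sum_x q_t(x)\sum_{y\neq x}R(y,x)\Big(s(y,x)-\tfrac{q_t(y)}{q_t(x)}-\tfrac{q_t(y)}{q_t(x)}\log\tfrac{s(y,x)}{q_t(y)/q_t(x)}\Big).$$ Assume (i) $\sum_{k=0}^{N-1}h_k\,\mathcal L_{SE}(T-t_k;s_{T-t_k})\le\varepsilon_{\rm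 score}$ and (ii) $s_{T-t_k}(x,y)\in[M^{-1},M]$ for all $x,y\in\mathcal X$ and $0\le k<N$, where $M\ge1$. **Samplers.** Both samplers start from the uniform law on $\mathcal X$ and, given $x=x_{t_k}$, draw the coordinates of $x_{t_{k+1}}$ independently. Write $x^{-i}\oplus_i a$ for $x$ with $i$-th coordinate replaced by $a$. For $a\ne x^i$, the probability that $x^i_{t_{k+1}}=a$ is, for the *Euler method*, $$h_k\,R(x^{-i}\oplus_i a,x)\,s_{T-t_k}(x^{-i}\oplus_i a,x),$$ and for *Tweedie $\tau$-leaping*, $$\Big(\sum_{c\in[S]}\big[e^{-h_kR_{\rm base}}\big]_{a,c}\,s_{T-t_k}(x^{-i}\oplus_i c,x)\Big)\big[e^{h_kR_{\rm base}}\big]_{a,x^i};$$ with the remaining probability $x^i_{t_{k+1}}=x^i$. Let $p_{T-\delta}$ be the law of $x_{t_N}$. **Theorem.** There is an absolute constant $C>0$ such that the following holds. 1. $\mathrm{TV}(q_0,q_\delta)\le C\,d\,\delta$ for every $\delta>0$. 2. Suppose $h_k\le\kappa\min\{1,T-t_k\}$ for all $k$, where $\kappa>0$ is small relative to $M$: $\kappa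 M\le\frac12$ for the Euler method, $\kappa M^2\le\frac12$ for Tweedie $\tau$-leaping. Then all the transition probabilities above are genuine probabilities, and for either sampler $$\mathrm{KL}(q_\delta\,\|\,p_{T-\delta})\le C\Big(d(\log S)e^{-T}+\varepsilon_{\rm score}+\kappa d^2S\big(T+\log(MS\delta^{-1})\big)\Big).$$ 3. Let $\varepsilon>0$ and $T=\log(d(\log S)/\varepsilon)$, with $T>\delta$. For every integer $$N\ \ge\ C\,\frac{d^2S}{\varepsilon}\,\big(T+\log(MS\delta^{-1})\big)^2$$ there are $\kappa>0$ and points $0=t_0<\dots<t_N=T-\delta$ with $t_{k+1}-t_k=\kappa\min\{1,T-t_k\}$ for all $k<N$, such that for every $q_0$ and all score estimates satisfying (i) and (ii), the sampler is well defined and $\mathrm{KL}(q_\delta\|p_{T-\delta})\le C(\varepsilon+\varepsilon_{\rm score})$; for the Euler method this is claimed when $\varepsilon M\le d^2S$, for Tweedie $\tau$-leaping when $\varepsilon M^2\le d^2S$. Thus $N=\tilde O(d^2S/\varepsilon)$ steps suffice. -/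

import Mathlib

noncomputable section

namespace DiscreteDiffusion

/-- Sequences of `d` tokens from a vocabulary of size `S`. -/
abbrev State (d S : ℕ) : Type := Fin d → Fin S

/-- `p` is a probability mass function on the finite type `α`. -/
def IsPMF {α : Type*} [Fintype α] (p : α → ℝ) : Prop :=
  (∀ x, 0 ≤ p x) ∧ ∑ x, p x = 1

/-- The measure with mass function `p`. -/
def toMeasure {d S : ℕ} (p : State d S → ℝ) : MeasureTheory.Measure (State d S) :=
  ∑ x, ENNReal.ofReal (p x) • MeasureTheory.Measure.dirac x

/-- Kullback-Leibler divergence `KL(q ‖ p)`, with value `∞` unless `q` is absolutely continuous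
with respect to `p`. -/
def KL {d S : ℕ} (q p : State d S → ℝ) : ENNReal :=
  InformationTheory.klDiv (toMeasure q) (toMeasure p)

/-- Total variation distance of two mass functions. -/
def TV {d S : ℕ} (p q : State d S → ℝ) : ℝ :=
  (1 / 2) * ∑ x, |p x - q x|

/-! ### The forward process -/

/-- The token rate matrix `(1/S) 1 1ᵀ - I`. -/
def Rbase (S : ℕ) : Matrix (Fin S) (Fin S) ℝ :=
  Matrix.of (fun _ _ => (1 : ℝ) / S) - 1

/-- Off-diagonal rates of the forward process: the token rate at the only coordinate in which
`x` and `y` differ if their Hamming distance is one, and zero otherwise. -/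
def offRate {d S : ℕ} (x y : State d S) : ℝ :=
  if hammingDist x y = 1 then
    ∑ i ∈ Finset.univ.filter (fun i => x i ≠ y i), Rbase S (x i) (y i)
  else 0

/-- The rate matrix of the forward process; its rows sum to zero. -/
def fwdRate (d S : ℕ) : Matrix (State d S) (State d S) ℝ :=
  Matrix.of fun x y =>
    if x = y then - ∑ z ∈ Finset.univ.filter (fun z => z ≠ x), offRate x z else offRate x y

/-- The law at time `t` of the continuous-time Markov chain with rate matrix `fwdRate` and initial
law `q₀`, that is, the solution of the Kolmogorov forward equation. -/
def fwdLaw {d S : ℕ} (q₀ : State d S → ℝ) (t : ℝ) : State d S → ℝ :=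
  Matrix.vecMul q₀ (NormedSpace.exp (t • fwdRate d S))

/-- The score entropy loss at time `t` of a score estimate `s`, where `s y x` estimates
`q_t(y) / q_t(x)`. -/
def scoreEntropy {d S : ℕ} (q₀ : State d S → ℝ) (t : ℝ) (s : State d S → State d S → ℝ) : ℝ :=
  ∑ x, fwdLaw q₀ t x * ∑ y ∈ Finset.univ.filter (fun y => y ≠ x),
    fwdRate d S y x *
      (s y x - fwdLaw q₀ t y / fwdLaw q₀ t x
        - fwdLaw q₀ t y / fwdLaw q₀ t x *
            Real.log (s y x / (fwdLaw q₀ t y / fwdLaw q₀ t x)))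

/-! ### Discretization and assumptions -/

/-- Discretization points `0 = t_0 < ... < t_N = T - δ`. -/
def IsGrid (T δ : ℝ) (N : ℕ) (t : ℕ → ℝ) : Prop :=
  t 0 = 0 ∧ t N = T - δ ∧ ∀ k < N, t k < t (k + 1)

/-- The score error, averaged over the grid, is at most `εscore`. Here `s u` is the score estimate
at forward time `u`. -/
def ScoreError {d S : ℕ} (q₀ : State d S → ℝ) (T : ℝ) (N : ℕ) (t : ℕ → ℝ)
    (s : ℝ → State d S → State d S → ℝ) (εscore : ℝ) : Prop :=
  ∑ k ∈ Finset.range N, (t (k + 1) - t k) * scoreEntropy q₀ (T - t k) (s (T - t k)) ≤ εscore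

/-- The score estimates on the grid take values in `[M⁻¹, M]`. -/
def ScoreBounded {d S : ℕ} (T : ℝ) (N : ℕ) (t : ℕ → ℝ)
    (s : ℝ → State d S → State d S → ℝ) (M : ℝ) : Prop :=
  ∀ k < N, ∀ x y, s (T - t k) x y ∈ Set.Icc M⁻¹ M

/-! ### The samplers -/

/-- Estimated rate at which coordinate `i` of the current state `x` moves to `a ≠ x i`, given the
score estimate `s`. -/
def tokenRate {d S : ℕ} (s : State d S → State d S → ℝ) (x : State d S) (i : Fin d)
    (a : Fin S) : ℝ :=
  fwdRate d S (Function.update x i a) x * s (Function.update x i a) x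

/-- One step of size `h` of the Euler method: probability that coordinate `i` of the current state
`x` becomes `a`. -/
def eulerToken {d S : ℕ} (s : State d S → State d S → ℝ) (h : ℝ) (x : State d S) (i : Fin d)
    (a : Fin S) : ℝ :=
  if a = x i then 1 + (- ∑ b ∈ Finset.univ.filter (fun b => b ≠ x i), tokenRate s x i b) * h
  else tokenRate s x i a * h

/-- Tweedie tau-leaping, probability of a move of coordinate `i` to `a ≠ x i` in a step of
size `h`. -/
def tweedieMove {d S : ℕ} (s : State d S → State d S → ℝ) (h : ℝ) (x : State d S) (i : Fin d)
    (a : Fin S) : ℝ :=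
  (∑ c, NormedSpace.exp ((-h) • Rbase S) a c * s (Function.update x i c) x) *
    NormedSpace.exp (h • Rbase S) a (x i)

/-- One step of size `h` of Tweedie tau-leaping: probability that coordinate `i` of the current
state `x` becomes `a`. -/
def tweedieToken {d S : ℕ} (s : State d S → State d S → ℝ) (h : ℝ) (x : State d S) (i : Fin d)
    (a : Fin S) : ℝ :=
  if a = x i then 1 - ∑ b ∈ Finset.univ.filter (fun b => b ≠ x i), tweedieMove s h x i b
  else tweedieMove s h x i a

/-- Law after `k` steps of the sampler that starts from the uniform law and in its `k`-th step,
given the current state `x`, draws the new coordinates independently, the `i`-th one with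
law `P k x i`. -/
def samplerLaw {d S : ℕ} (P : ℕ → State d S → Fin d → Fin S → ℝ) : ℕ → State d S → ℝ
  | 0 => fun _ => 1 / (S : ℝ) ^ d
  | k + 1 => fun y => ∑ x, samplerLaw P k x * ∏ i, P k x i (y i)

/-- Coordinate laws of the Euler method on the grid `t`. -/
def eulerStep {d S : ℕ} (T : ℝ) (t : ℕ → ℝ) (s : ℝ → State d S → State d S → ℝ) (k : ℕ) :
    State d S → Fin d → Fin S → ℝ :=
  eulerToken (s (T - t k)) (t (k + 1) - t k)

/-- Coordinate laws of Tweedie tau-leaping on the grid `t`. -/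
def tweedieStep {d S : ℕ} (T : ℝ) (t : ℕ → ℝ) (s : ℝ → State d S → State d S → ℝ) (k : ℕ) :
    State d S → Fin d → Fin S → ℝ :=
  tweedieToken (s (T - t k)) (t (k + 1) - t k)

/-- The sampler with coordinate laws `P` is well defined for `N` steps (all its coordinate laws are
probability mass functions), and the KL divergence from `q` to its output law is at most `B`. -/
def SamplesWithin {d S : ℕ} (P : ℕ → State d S → Fin d → Fin S → ℝ) (N : ℕ)
    (q : State d S → ℝ) (B : ℝ) : Prop :=
  (∀ k < N, ∀ x i, IsPMF (P k x i)) ∧ KL q (samplerLaw P N) ≤ ENNReal.ofReal B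

end DiscreteDiffusion

end

/-! Fix a step, let `h` be its length and `u` the forward time that remains after it, and write K
for the transition kernel of the forward process. The exact reverse transition from x at time u + h
to z at time u is the posterior q_u(z) K_h(z, x) / q_{u+h}(x). By the log sum inequality, one
sampler step increases the divergence from the true law by at most the averaged divergence of this
posterior from the product law drawn by the sampler (`klSum_step_le`). Everything is a finite sum;
no path measures are needed.

The coordinates evolve independently, so K_h is a product (`exp_smul_fwdRate`). The logarithm of
posterior over sampler therefore splits into the entropy difference of q_u and q_{u+h} and one term
per coordinate, which involves only the posterior marginal of that coordinate. Tweedie's formula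
writes this marginal through the scores at time u + h (`pairMass_of_ne`).

Let I be the entropy production (`entropyRate`). It decreases along the flow, so the entropy
difference is at most h I(q_u). The coordinate terms are at most -h I(q_{u+h}) + 59 h L_SE plus an
error of order h κ S d (`token_bound`, `sum_mul_score`). The first order parts nearly cancel: what
is left is h (I(q_u) - I(q_{u+h})), and since h ≤ κ and I is monotone, these differences telescope
to at most κ I(q_δ) ≤ κ d log(1 + S/δ). Together with d (log S) e^{-T} for the uniform start this
gives the bound, even with d in place of d² in the discretization term.

The only regularity used is that probabilities of neighbouring states at time t have ratio at most 1
+ S/t. The condition h ≤ κ min(1, t) is matched to it: h times this ratio is at most 2 κ S. Both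
samplers are treated at once as perturbed Euler steps (`IsPerturbedStep`); the bound `M` makes their
moves rare and the Tweedie correction small. -/

noncomputable section
namespace DiscreteDiffusion

/-- A differentiable solution of `F' = F A`, `F 0 = 1` is the exponential semigroup of `A`. -/
theorem exp_smul_eq_of_hasDerivAt {𝔸 : Type*} [NormedRing 𝔸] [NormedAlgebra ℝ 𝔸] [CompleteSpace 𝔸]
    {A : 𝔸} {F : ℝ → 𝔸} (h0 : F 0 = 1) (hF : ∀ t, HasDerivAt F (F t * A) t) (t : ℝ) :
    NormedSpace.exp (t • A) = F t := by
  have hE : ∀ r : ℝ, HasDerivAt (fun r : ℝ => NormedSpace.exp (-r • A))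
      (-(A * NormedSpace.exp (-r • A))) r := by
    intro r
    have h1 := (hasDerivAt_exp_smul_const' (𝕂 := ℝ) A (-r)).scomp r (hasDerivAt_neg r)
    simpa [Function.comp_def] using h1
  have hG : ∀ r : ℝ, HasDerivAt (fun r : ℝ => F r * NormedSpace.exp (-r • A)) 0 r := by
    intro r
    have := (hF r).fun_mul (hE r)
    rwa [mul_neg, mul_assoc, add_neg_cancel] at this
  have hc : F t * NormedSpace.exp (-t • A) = F 0 * NormedSpace.exp (-(0 : ℝ) • A) :=
    is_const_of_deriv_eq_zero (fun r => (hG r).differentiableAt) (fun r => (hG r).deriv) t 0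
  let +nondep : NormedAlgebra ℚ 𝔸 := NormedAlgebra.restrictScalars ℚ ℝ 𝔸
  have hinv : NormedSpace.exp (-t • A) * NormedSpace.exp (t • A) = 1 := by
    rw [← NormedSpace.exp_add_of_commute]
    · simp
    · exact (Commute.refl A).smul_left _ |>.smul_right _
  calc NormedSpace.exp (t • A) = (F t * NormedSpace.exp (-t • A)) * NormedSpace.exp (t • A) := by
        rw [hc, h0]; simp
    _ = F t := by rw [mul_assoc, hinv, mul_one]

/-! ### Matrix exponentials identified through entrywise differential equations -/

open scoped Matrix.Norms.Operator in
theorem matrix_exp_smul_eq_of_hasDerivAt {n : Type*} [Fintype n] [DecidableEq n]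
    {A : Matrix n n ℝ} {F : ℝ → Matrix n n ℝ} (h0 : F 0 = 1)
    (hF : ∀ t i j, HasDerivAt (fun r => F r i j) ((F t * A) i j) t) (t : ℝ) :
    NormedSpace.exp (t • A) = F t := by
  have hd : ∀ r, HasDerivAt F (F r * A) r := fun r =>
    (hasDerivAt_pi.2 fun i => hasDerivAt_pi.2 fun j => hF r i j :
      @HasDerivAt ℝ _ (n → n → ℝ) _ _ _ _ F (F r * A) r)
  exact exp_smul_eq_of_hasDerivAt h0 hd t

/-! ### The heat kernel in product form -/

/-- Transition probabilities of a single token. -/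
def tokenKernel (S : ℕ) (t : ℝ) (a b : Fin S) : ℝ :=
  Real.exp (-t) * (if a = b then 1 else 0) + (1 - Real.exp (-t)) / S

theorem tokenKernel_comm {S : ℕ} (t : ℝ) (a b : Fin S) :
    tokenKernel S t a b = tokenKernel S t b a := by
  simp [tokenKernel, eq_comm]

theorem tokenKernel_of_ne {S : ℕ} (t : ℝ) {a b : Fin S} (h : a ≠ b) :
    tokenKernel S t a b = (1 - Real.exp (-t)) / S := by
  simp [tokenKernel, h]

theorem tokenKernel_self {S : ℕ} (t : ℝ) (a : Fin S) :
    tokenKernel S t a a = Real.exp (-t) + (1 - Real.exp (-t)) / S := by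
  simp [tokenKernel]

theorem sum_tokenKernel {S : ℕ} (t : ℝ) (a : Fin S) : ∑ b, tokenKernel S t a b = 1 := by
  have hS : (S : ℝ) ≠ 0 := by
    have := a.pos
    positivity
  simp only [tokenKernel, Finset.sum_add_distrib, ← Finset.mul_sum]
  simp
  field_simp
  ring

theorem one_sub_exp_neg_pos {t : ℝ} (ht : 0 < t) : 0 < 1 - Real.exp (-t) := by
  have : Real.exp (-t) < 1 := Real.exp_lt_one_iff.2 (by linarith)
  linarith

theorem tokenKernel_pos {S : ℕ} {t : ℝ} (ht : 0 < t) (a b : Fin S) : 0 < tokenKernel S t a b := by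
  have hS : (0 : ℝ) < S := by exact_mod_cast a.pos
  have h1 := div_pos (one_sub_exp_neg_pos ht) hS
  unfold tokenKernel
  have := Real.exp_pos (-t)
  split_ifs <;> nlinarith

theorem hasDerivAt_tokenKernel {S : ℕ} (t : ℝ) (a b : Fin S) :
    HasDerivAt (fun r => tokenKernel S r a b) (1 / S - tokenKernel S t a b) t := by
  have h1 : HasDerivAt (fun r : ℝ => Real.exp (-r)) (-Real.exp (-t)) t := by
    simpa using (hasDerivAt_neg t).exp
  have h2 := (h1.mul_const (if a = b then (1 : ℝ) else 0)).add
    ((h1.const_sub 1).div_const (S : ℝ))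
  refine h2.congr_deriv ?_
  simp only [tokenKernel]
  ring

theorem sum_mul_Rbase {S : ℕ} (f : Fin S → ℝ) (b : Fin S) :
    ∑ c, f c * Rbase S c b = (∑ c, f c) / S - f b := by
  simp [Rbase, Matrix.sub_apply, mul_sub, Finset.sum_sub_distrib, Matrix.one_apply,
    ← Finset.sum_mul, div_eq_mul_inv]

theorem exp_smul_Rbase {S : ℕ} (t : ℝ) (a b : Fin S) :
    NormedSpace.exp (t • Rbase S) a b = tokenKernel S t a b := by
  have h := matrix_exp_smul_eq_of_hasDerivAt (A := Rbase S)
    (F := fun r => Matrix.of (tokenKernel S r)) ?_ ?_ t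
  · rw [h]
    rfl
  · ext a b
    simp [tokenKernel, Matrix.one_apply]
  · intro t a b
    rw [Matrix.mul_apply]
    simp only [Matrix.of_apply, sum_mul_Rbase, sum_tokenKernel]
    exact hasDerivAt_tokenKernel t a b

/-- Transition probabilities of the forward process. -/
def kernel {d S : ℕ} (t : ℝ) (z x : State d S) : ℝ := ∏ i, tokenKernel S t (z i) (x i)

/-- Transition probabilities of the coordinates other than `i`. -/
def restKernel {d S : ℕ} (t : ℝ) (i : Fin d) (z x : State d S) : ℝ :=
  ∏ j ∈ Finset.univ.erase i, tokenKernel S t (z j) (x j)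

section kernel

variable {d S : ℕ}

theorem kernel_comm (t : ℝ) (z x : State d S) : kernel t z x = kernel t x z :=
  Finset.prod_congr rfl fun _ _ => tokenKernel_comm _ _ _

theorem restKernel_comm (t : ℝ) (i : Fin d) (z x : State d S) :
    restKernel t i z x = restKernel t i x z :=
  Finset.prod_congr rfl fun _ _ => tokenKernel_comm _ _ _

theorem kernel_eq (t : ℝ) (i : Fin d) (z x : State d S) :
    kernel t z x = tokenKernel S t (z i) (x i) * restKernel t i z x :=
  (Finset.mul_prod_erase _ _ (Finset.mem_univ i)).symm

theorem restKernel_update (t : ℝ) (i : Fin d) (z x : State d S) (a : Fin S) :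
    restKernel t i z (Function.update x i a) = restKernel t i z x := by
  refine Finset.prod_congr rfl fun j hj => ?_
  rw [Function.update_of_ne (Finset.ne_of_mem_erase hj)]

theorem kernel_update (t : ℝ) (i : Fin d) (z x : State d S) (a : Fin S) :
    kernel t z (Function.update x i a) = tokenKernel S t (z i) a * restKernel t i z x := by
  rw [kernel_eq t i, restKernel_update, Function.update_self]

theorem sum_kernel_update (t : ℝ) (i : Fin d) (z x : State d S) :
    ∑ a, kernel t z (Function.update x i a) = restKernel t i z x := by
  simp only [kernel_update, ← Finset.sum_mul, sum_tokenKernel, one_mul]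

theorem sum_kernel_update_left (t : ℝ) (i : Fin d) (z x : State d S) :
    ∑ a, kernel t (Function.update z i a) x = restKernel t i z x := by
  simp only [kernel_comm t _ x, sum_kernel_update, restKernel_comm t i x z]

theorem kernel_pos {t : ℝ} (ht : 0 < t) (z x : State d S) : 0 < kernel t z x :=
  Finset.prod_pos fun _ _ => tokenKernel_pos ht _ _

theorem sum_kernel (t : ℝ) (z : State d S) : ∑ x, kernel t z x = 1 := by
  have := Finset.prod_univ_sum (fun _ : Fin d => (Finset.univ : Finset (Fin S)))
    (fun i a => tokenKernel S t (z i) a)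
  simp only [sum_tokenKernel, Finset.prod_const_one, Fintype.piFinset_univ] at this
  exact this.symm

theorem update_apply_ne_iff (x : State d S) {i : Fin d} {a : Fin S} (ha : a ≠ x i) (j : Fin d) :
    Function.update x i a j ≠ x j ↔ j = i := by
  by_cases h : j = i
  · subst h; simp [ha]
  · simp [h]

theorem update_ne_self (x : State d S) {i : Fin d} {a : Fin S} (ha : a ≠ x i) :
    Function.update x i a ≠ x :=
  fun he => (update_apply_ne_iff x ha i).2 rfl (congrFun he i)

theorem fwdRate_update (x : State d S) {i : Fin d} {a : Fin S} (ha : a ≠ x i) :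
    fwdRate d S (Function.update x i a) x = 1 / S := by
  have hf : Finset.univ.filter (fun j => Function.update x i a j ≠ x j) = {i} := by
    ext j
    simp [update_apply_ne_iff x ha j]
  have hd : hammingDist (Function.update x i a) x = 1 := by
    unfold hammingDist
    rw [hf]
    simp
  simp only [fwdRate, Matrix.of_apply, update_ne_self x ha, if_false, offRate, hd, if_true]
  rw [hf, Finset.sum_singleton, Function.update_self]
  simp [Rbase, Matrix.sub_apply, ha]

/-- Only Hamming neighbours of `x` carry a rate, and the pairs (i, a) with a ≠ x i parametrize them
without repetition. -/
theorem sum_fwdRate_mul_of_ne (f : State d S → ℝ) (x : State d S) :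
    ∑ y ∈ Finset.univ.filter (fun y => y ≠ x), fwdRate d S y x * f y =
      ∑ i, ∑ a ∈ Finset.univ.filter (fun a => a ≠ x i),
        (1 / S : ℝ) * f (Function.update x i a) := by
  rw [Finset.sum_sigma']
  symm
  refine Finset.sum_of_injOn (fun p => Function.update x p.1 p.2) ?_ ?_ ?_ ?_
  · rintro ⟨i, a⟩ h ⟨j, b⟩ h' he
    simp only [Finset.coe_sigma, Set.mem_sigma_iff, Finset.mem_coe, Finset.mem_filter,
      Finset.mem_univ, true_and] at h h' he
    have hi : i = j := (update_apply_ne_iff x h' i).1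
      (he ▸ (update_apply_ne_iff x h i).2 rfl)
    subst hi
    have := congrFun he i
    simpa using this
  · rintro ⟨i, a⟩ h
    simp only [Finset.coe_sigma, Set.mem_sigma_iff, Finset.mem_coe, Finset.mem_filter,
      Finset.mem_univ, true_and] at h ⊢
    exact update_ne_self x h
  · intro y hy hy'
    have hyx : y ≠ x := by simpa using hy
    suffices h : hammingDist y x ≠ 1 by simp [fwdRate, hyx, offRate, h]
    intro h
    obtain ⟨i, hi⟩ := Finset.card_eq_one.1 h
    have hi' : ∀ j, y j ≠ x j ↔ j = i := fun j => by
      have := Finset.ext_iff.1 hi j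
      simpa using this
    refine hy' ⟨⟨i, y i⟩, ?_, ?_⟩
    · simp [(hi' i).2 rfl]
    · funext j
      by_cases hj : j = i
      · subst hj; simp
      · have := (hi' j).not.2 hj
        simp [hj, not_not.1 this]
  · rintro ⟨i, a⟩ h
    have ha : a ≠ x i := by simpa using h
    rw [fwdRate_update x ha]

theorem fwdRate_comm (x y : State d S) : fwdRate d S x y = fwdRate d S y x := by
  by_cases h : x = y
  · rw [h]
  · simp only [fwdRate, Matrix.of_apply, h, Ne.symm h, if_false, offRate, hammingDist_comm x y]
    congr 1
    refine Finset.sum_congr (by ext; simp [eq_comm]) fun i hi => ?_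
    simp [Rbase, Matrix.sub_apply, Matrix.one_apply, eq_comm]

/-- The diagonal entry supplies the missing term a = x i of each average, so the generator becomes a
sum over coordinates of (average over the coordinate) minus identity. -/
theorem sum_mul_fwdRate (f : State d S → ℝ) (x : State d S) :
    ∑ y, f y * fwdRate d S y x = ∑ i, ((∑ a, f (Function.update x i a)) / S - f x) := by
  have hdiag : fwdRate d S x x =
      -∑ i : Fin d, ∑ a ∈ Finset.univ.filter (fun a => a ≠ x i), (1 / S : ℝ) := by
    have h := sum_fwdRate_mul_of_ne (fun _ => 1) x
    simp only [mul_one] at h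
    rw [← h]
    simp only [fwdRate, Matrix.of_apply, if_true]
    congr 1
    refine Finset.sum_congr rfl fun y hy => ?_
    have hyx : y ≠ x := by simpa using hy
    have := fwdRate_comm x y
    simp only [fwdRate, Matrix.of_apply, hyx, Ne.symm hyx, if_false] at this
    rw [this, if_neg hyx]
  rw [← Finset.sum_filter_add_sum_filter_not Finset.univ (fun y => y ≠ x)]
  simp only [mul_comm (f _), sum_fwdRate_mul_of_ne, not_not, Finset.filter_eq', Finset.mem_univ,
    if_true, Finset.sum_singleton, hdiag]
  rw [neg_mul, ← sub_eq_add_neg, Finset.sum_mul, ← Finset.sum_sub_distrib]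
  refine Finset.sum_congr rfl fun i _ => ?_
  have hS : (S : ℝ) ≠ 0 := by
    have := (x i).pos
    positivity
  have h1 : ∑ a, (1 / S : ℝ) * f (Function.update x i a) =
      ∑ a ∈ Finset.univ.filter (fun a => a ≠ x i), (1 / S : ℝ) * f (Function.update x i a)
        + 1 / S * f x := by
    rw [← Finset.sum_filter_add_sum_filter_not Finset.univ (fun a => a ≠ x i)]
    simp [Finset.filter_eq']
  have h2 : ∑ a : Fin S, (1 / S : ℝ) =
      ∑ a ∈ Finset.univ.filter (fun a => a ≠ x i), (1 / S : ℝ) + 1 / S := by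
    rw [← Finset.sum_filter_add_sum_filter_not Finset.univ (fun a => a ≠ x i)]
    simp [Finset.filter_eq']
  have h3 : ∑ a : Fin S, (1 / S : ℝ) = 1 := by simp [hS]
  rw [← Finset.mul_sum] at h1
  have h4 : ∑ a ∈ Finset.univ.filter (fun a => a ≠ x i), (1 / S : ℝ) = 1 - 1 / S := by linarith
  rw [h4, ← sub_eq_iff_eq_add.2 h1]
  ring

theorem hasDerivAt_kernel (t : ℝ) (z x : State d S) :
    HasDerivAt (fun r => kernel r z x)
      (∑ i, ((∑ a, kernel t z (Function.update x i a)) / S - kernel t z x)) t := by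
  have h := HasDerivAt.fun_finsetProd (u := Finset.univ)
    (fun i (_ : i ∈ Finset.univ) => hasDerivAt_tokenKernel t (z i) (x i))
  refine h.congr_deriv (Finset.sum_congr rfl fun i _ => ?_)
  rw [sum_kernel_update, kernel_eq t i, smul_eq_mul]
  simp only [restKernel]
  ring

/-- The product kernel solves the Kolmogorov equation: by the product rule one factor at a time is
differentiated, and averaging over coordinate i replaces its factor by 1/S. -/
theorem exp_smul_fwdRate (t : ℝ) :
    NormedSpace.exp (t • fwdRate d S) = Matrix.of (kernel t) := by
  refine matrix_exp_smul_eq_of_hasDerivAt (F := fun r => Matrix.of (kernel r)) ?_ ?_ t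
  · ext z x
    simp only [Matrix.of_apply, kernel, tokenKernel, Matrix.one_apply]
    by_cases h : z = x
    · simp [h]
    · obtain ⟨i, hi⟩ := Function.ne_iff.1 h
      rw [if_neg h]
      exact Finset.prod_eq_zero (Finset.mem_univ i) (by simp [hi])
  · intro t z x
    rw [Matrix.mul_apply]
    simp only [Matrix.of_apply, sum_mul_fwdRate]
    exact hasDerivAt_kernel t z x

end kernel

/-! ### The law of the forward process -/

section law

variable {d S : ℕ}

theorem fwdLaw_apply (q : State d S → ℝ) (t : ℝ) (x : State d S) :
    fwdLaw q t x = ∑ z, q z * kernel t z x := by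
  simp [fwdLaw, exp_smul_fwdRate, Matrix.vecMul, dotProduct]

theorem fwdLaw_add (q : State d S → ℝ) (u h : ℝ) : fwdLaw q (u + h) = fwdLaw (fwdLaw q u) h := by
  unfold fwdLaw
  rw [Matrix.vecMul_vecMul, add_smul, Matrix.exp_add_of_commute]
  exact ((Commute.refl (fwdRate d S)).smul_left _).smul_right _

theorem IsPMF.fwdLaw_pos {q : State d S → ℝ} (hq : IsPMF q) {t : ℝ} (ht : 0 < t)
    (x : State d S) : 0 < fwdLaw q t x := by
  rw [fwdLaw_apply]
  have hne : ∃ z, 0 < q z := by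
    by_contra! h
    have := Finset.sum_nonpos fun z (_ : z ∈ Finset.univ) => h z
    linarith [hq.2]
  obtain ⟨z, hz⟩ := hne
  exact Finset.sum_pos' (fun z _ => mul_nonneg (hq.1 z) (kernel_pos ht z x).le)
    ⟨z, Finset.mem_univ z, mul_pos hz (kernel_pos ht z x)⟩

theorem sum_fwdLaw (q : State d S → ℝ) (t : ℝ) : ∑ x, fwdLaw q t x = ∑ x, q x := by
  simp only [fwdLaw_apply]
  rw [Finset.sum_comm]
  simp only [← Finset.mul_sum, sum_kernel, mul_one]

theorem IsPMF.fwdLaw {q : State d S → ℝ} (hq : IsPMF q) {t : ℝ} (ht : 0 < t) :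
    IsPMF (fwdLaw q t) :=
  ⟨fun x => (hq.fwdLaw_pos ht x).le, by rw [sum_fwdLaw, hq.2]⟩

/-! ### Averages over one coordinate -/

/-- The average of `f` over the `i`-th coordinate. -/
def avg (i : Fin d) (f : State d S → ℝ) (x : State d S) : ℝ :=
  (∑ a, f (Function.update x i a)) / S

theorem hasDerivAt_fwdLaw (q : State d S → ℝ) (t : ℝ) (x : State d S) :
    HasDerivAt (fun r => fwdLaw q r x) (∑ i, (avg i (fwdLaw q t) x - fwdLaw q t x)) t := by
  simp only [fwdLaw_apply]
  have h := HasDerivAt.fun_sum (u := Finset.univ) fun z (_ : z ∈ Finset.univ) =>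
    (hasDerivAt_kernel t z x).const_mul (q z)
  refine h.congr_deriv ?_
  simp only [Finset.mul_sum]
  rw [Finset.sum_comm]
  refine Finset.sum_congr rfl fun i _ => ?_
  simp only [avg, fwdLaw_apply, mul_sub, Finset.sum_sub_distrib]
  rw [Finset.sum_comm (γ := Fin S), Finset.sum_div]
  congr 1
  refine Finset.sum_congr rfl fun z _ => ?_
  rw [← Finset.mul_sum, mul_div_assoc]

/-- Exchanging the old and the new value of coordinate i is an involution on pairs (x, a). It makes
`avg` self-adjoint. -/
theorem sum_update_swap (i : Fin d) (G : State d S → State d S → ℝ) :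
    ∑ x, ∑ a, G x (Function.update x i a) = ∑ x, ∑ a, G (Function.update x i a) x := by
  rw [← Finset.univ.sum_product' Finset.univ (fun x a => G x (Function.update x i a)),
    ← Finset.univ.sum_product' Finset.univ (fun x a => G (Function.update x i a) x)]
  refine Finset.sum_nbij' (fun p => (Function.update p.1 i p.2, p.1 i))
    (fun p => (Function.update p.1 i p.2, p.1 i)) ?_ ?_ ?_ ?_ ?_ <;> simp

theorem sum_avg_mul (i : Fin d) (f g : State d S → ℝ) :
    ∑ x, avg i f x * g x = ∑ x, f x * avg i g x := by
  have h := sum_update_swap i (fun x y => f y * g x / S)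
  simp only [avg, div_mul_eq_mul_div, mul_div_assoc', Finset.sum_mul, Finset.mul_sum,
    Finset.sum_div]
  exact h

theorem avg_update (i : Fin d) (f : State d S → ℝ) (x : State d S) (a : Fin S) :
    avg i f (Function.update x i a) = avg i f x := by
  simp [avg]

theorem avg_const_of_update (i : Fin d) (f : State d S → ℝ)
    (hf : ∀ x a, f (Function.update x i a) = f x) (x : State d S) : avg i f x = f x := by
  have hS : (S : ℝ) ≠ 0 := by
    have := (x i).pos
    positivity
  simp [avg, hf, mul_div_cancel_left₀ _ hS]

theorem sum_avg (i : Fin d) (f : State d S → ℝ) : ∑ x, avg i f x = ∑ x, f x := by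
  have h := sum_avg_mul i f (fun _ => 1)
  simp only [mul_one] at h
  rw [h]
  refine Finset.sum_congr rfl fun x _ => ?_
  rw [avg_const_of_update i (fun _ => 1) (fun _ _ => rfl), mul_one]

theorem avg_pos (i : Fin d) {f : State d S → ℝ} (hf : ∀ x, 0 < f x) (x : State d S) :
    0 < avg i f x := by
  have hS : (0 : ℝ) < S := by exact_mod_cast (x i).pos
  exact div_pos (Finset.sum_pos (fun a _ => hf _) ⟨x i, Finset.mem_univ _⟩) hS

/-- Averaging the kernel over coordinate i of either argument gives the same function `restKernel` /
S, so averaging commutes with the flow. -/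
theorem avg_fwdLaw (i : Fin d) (q : State d S → ℝ) (t : ℝ) (x : State d S) :
    avg i (fwdLaw q t) x = fwdLaw (avg i q) t x := by
  rw [fwdLaw_apply, sum_avg_mul]
  simp only [avg, fwdLaw_apply]
  rw [Finset.sum_comm, Finset.sum_div]
  refine Finset.sum_congr rfl fun z _ => ?_
  rw [← Finset.mul_sum, sum_kernel_update, sum_kernel_update_left, mul_div_assoc]

/-! ### Ratios of neighbouring probabilities -/

theorem exp_neg_le_div {t : ℝ} (ht : 0 < t) : Real.exp (-t) ≤ (1 - Real.exp (-t)) / t := by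
  rw [le_div_iff₀ ht]
  have h1 := Real.add_one_le_exp t
  have h2 : Real.exp (-t) * Real.exp t = 1 := by rw [← Real.exp_add]; simp
  nlinarith [Real.exp_pos (-t)]

/-- The worst case is a diagonal over an off-diagonal entry, with ratio 1 + S e^{-t} / (1 - e^{-t}).
Mixtures over initial states inherit the bound, so true scores between neighbours lie between (1 +
S/t)⁻¹ and 1 + S/t. -/
theorem tokenKernel_le {t : ℝ} (ht : 0 < t) (c a b : Fin S) :
    tokenKernel S t c a ≤ (1 + S / t) * tokenKernel S t c b := by
  have hS : (0 : ℝ) < S := by exact_mod_cast a.pos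
  have h0 := exp_neg_le_div ht
  have h1 : tokenKernel S t c a ≤ Real.exp (-t) + (1 - Real.exp (-t)) / S := by
    unfold tokenKernel
    have := Real.exp_pos (-t)
    split_ifs <;> linarith
  have h2 : (1 - Real.exp (-t)) / S ≤ tokenKernel S t c b := by
    unfold tokenKernel
    have := Real.exp_pos (-t)
    split_ifs <;> linarith
  calc tokenKernel S t c a ≤ (1 - Real.exp (-t)) / t + (1 - Real.exp (-t)) / S := by linarith
    _ = (1 + S / t) * ((1 - Real.exp (-t)) / S) := by field_simp; ring
    _ ≤ _ := by gcongr

theorem kernel_update_le {t : ℝ} (ht : 0 < t) (i : Fin d) (z x : State d S) (a : Fin S) :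
    kernel t z (Function.update x i a) ≤ (1 + S / t) * kernel t z x := by
  rw [kernel_update, kernel_eq t i, ← mul_assoc]
  exact mul_le_mul_of_nonneg_right (tokenKernel_le ht _ _ _)
    (Finset.prod_nonneg fun _ _ => (tokenKernel_pos ht _ _).le)

theorem IsPMF.fwdLaw_update_le {q : State d S → ℝ} (hq : IsPMF q) {t : ℝ} (ht : 0 < t) (i : Fin d)
    (x : State d S) (a : Fin S) :
    DiscreteDiffusion.fwdLaw q t (Function.update x i a) ≤
      (1 + S / t) * DiscreteDiffusion.fwdLaw q t x := by
  simp only [fwdLaw_apply, Finset.mul_sum]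
  refine Finset.sum_le_sum fun z _ => ?_
  rw [mul_left_comm]
  exact mul_le_mul_of_nonneg_left (kernel_update_le ht i z x a) (hq.1 z)

theorem IsPMF.fwdLaw_le_update {q : State d S → ℝ} (hq : IsPMF q) {t : ℝ} (ht : 0 < t) (i : Fin d)
    (x : State d S) (a : Fin S) :
    DiscreteDiffusion.fwdLaw q t x ≤
      (1 + S / t) * DiscreteDiffusion.fwdLaw q t (Function.update x i a) := by
  have := hq.fwdLaw_update_le ht i (Function.update x i a) (x i)
  simpa using this

end law

/-! ### Entropy along the forward process -/

/-- The log sum inequality. -/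
theorem log_sum_inequality {ι : Type*} (s : Finset ι) {a b : ι → ℝ} (ha : ∀ j ∈ s, 0 < a j)
    (hb : ∀ j ∈ s, 0 < b j) :
    (∑ j ∈ s, a j) * Real.log ((∑ j ∈ s, a j) / ∑ j ∈ s, b j) ≤
      ∑ j ∈ s, a j * Real.log (a j / b j) := by
  rcases s.eq_empty_or_nonempty with rfl | hs
  · simp
  have hA := Finset.sum_pos ha hs
  have hB := Finset.sum_pos hb hs
  set A := ∑ j ∈ s, a j with hAdef
  set B := ∑ j ∈ s, b j with hBdef
  have h : ∀ j ∈ s, a j * Real.log (A / B) + (a j - b j * (A / B)) ≤ a j * Real.log (a j / b j) := by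
    intro j hj
    have h1 := ha j hj
    have h2 := hb j hj
    have h3 := Real.log_le_sub_one_of_pos (div_pos (div_pos hA hB) (div_pos h1 h2))
    rw [Real.log_div (div_pos hA hB).ne' (div_pos h1 h2).ne'] at h3
    have h4 : a j * (A / B / (a j / b j)) = b j * (A / B) := by field_simp
    nlinarith
  have h5 := Finset.sum_le_sum h
  rw [Finset.sum_add_distrib, Finset.sum_sub_distrib, ← Finset.sum_mul, ← Finset.sum_mul,
    ← hAdef, ← hBdef, mul_div_cancel₀ A hB.ne'] at h5
  linarith

section entropy

variable {d S : ℕ}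

/-- The negative Shannon entropy. -/
def negEntropy (q : State d S → ℝ) : ℝ := ∑ x, q x * Real.log (q x)

/-- The rate of entropy production of the forward process. -/
def entropyRate (q : State d S → ℝ) : ℝ :=
  ∑ i, ∑ x, (q x - avg i q x) * Real.log (q x)

/-- The logarithm of `avg i q` does not depend on coordinate i, hence is orthogonal to `q - avg i
q`. In this form each coordinate contributes the symmetrized divergence between `q` and `avg i q`,
so nonnegativity and monotonicity become visible. -/
theorem entropyRate_eq (q : State d S → ℝ) :
    entropyRate q =
      ∑ i, ∑ x, (q x - avg i q x) * (Real.log (q x) - Real.log (avg i q x)) := by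
  refine Finset.sum_congr rfl fun i _ => ?_
  have h1 := sum_avg_mul i q (fun x => Real.log (avg i q x))
  have h2 : ∀ x, avg i (fun x => Real.log (avg i q x)) x = Real.log (avg i q x) :=
    avg_const_of_update i _ fun x a => by rw [avg_update]
  simp only [h2] at h1
  simp only [mul_sub, Finset.sum_sub_distrib, sub_mul] at h1 ⊢
  linarith

theorem sub_mul_log_sub_nonneg {a b : ℝ} (ha : 0 < a) (hb : 0 < b) :
    0 ≤ (a - b) * (Real.log a - Real.log b) := by
  rcases le_total a b with h | h
  · exact mul_nonneg_of_nonpos_of_nonpos (by linarith)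
      (by linarith [Real.log_le_log ha h])
  · exact mul_nonneg (by linarith) (by linarith [Real.log_le_log hb h])

theorem entropyRate_nonneg {q : State d S → ℝ} (hq : ∀ x, 0 < q x) : 0 ≤ entropyRate q := by
  rw [entropyRate_eq]
  exact Finset.sum_nonneg fun i _ => Finset.sum_nonneg fun x _ =>
    sub_mul_log_sub_nonneg (hq x) (avg_pos i hq x)

theorem sub_mul_log_sub_sum_le {ι : Type*} (s : Finset ι) {a b : ι → ℝ} (hs : s.Nonempty)
    (ha : ∀ j ∈ s, 0 < a j) (hb : ∀ j ∈ s, 0 < b j) :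
    (∑ j ∈ s, a j - ∑ j ∈ s, b j) * (Real.log (∑ j ∈ s, a j) - Real.log (∑ j ∈ s, b j)) ≤
      ∑ j ∈ s, (a j - b j) * (Real.log (a j) - Real.log (b j)) := by
  have h1 := log_sum_inequality s ha hb
  have h2 := log_sum_inequality s hb ha
  have hA := Finset.sum_pos ha hs
  have hB := Finset.sum_pos hb hs
  rw [Real.log_div hA.ne' hB.ne'] at h1
  rw [Real.log_div hB.ne' hA.ne'] at h2
  have h3 : ∑ j ∈ s, (a j - b j) * (Real.log (a j) - Real.log (b j)) =
      ∑ j ∈ s, a j * Real.log (a j / b j) + ∑ j ∈ s, b j * Real.log (b j / a j) := by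
    rw [← Finset.sum_add_distrib]
    refine Finset.sum_congr rfl fun j hj => ?_
    rw [Real.log_div (ha j hj).ne' (hb j hj).ne', Real.log_div (hb j hj).ne' (ha j hj).ne']
    ring
  rw [h3]
  linarith

/-- Data processing for the symmetrized divergence: since averaging commutes with the flow, both `q`
and `avg i q` are pushed through the same kernel. -/
theorem entropyRate_fwdLaw_le {q : State d S → ℝ} (hq : ∀ x, 0 < q x) {h : ℝ} (hh : 0 < h) :
    entropyRate (fwdLaw q h) ≤ entropyRate q := by
  rw [entropyRate_eq, entropyRate_eq]
  refine Finset.sum_le_sum fun i _ => ?_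
  have key : ∀ x, (fwdLaw q h x - avg i (fwdLaw q h) x) *
      (Real.log (fwdLaw q h x) - Real.log (avg i (fwdLaw q h) x)) ≤
      ∑ z, (q z - avg i q z) * (Real.log (q z) - Real.log (avg i q z)) * kernel h z x := by
    intro x
    rw [avg_fwdLaw, fwdLaw_apply, fwdLaw_apply]
    refine (sub_mul_log_sub_sum_le Finset.univ ⟨x, Finset.mem_univ x⟩
      (fun z _ => mul_pos (hq z) (kernel_pos hh z x))
      (fun z _ => mul_pos (avg_pos i hq z) (kernel_pos hh z x))).trans_eq ?_
    refine Finset.sum_congr rfl fun z _ => ?_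
    have hk := (kernel_pos hh z x).ne'
    rw [Real.log_mul (hq z).ne' hk, Real.log_mul (avg_pos i hq z).ne' hk]
    ring
  refine (Finset.sum_le_sum fun x _ => key x).trans_eq ?_
  rw [Finset.sum_comm]
  simp only [← Finset.mul_sum, sum_kernel, mul_one]

theorem hasDerivAt_negEntropy {q : State d S → ℝ} (hq : IsPMF q) {t : ℝ} (ht : 0 < t) :
    HasDerivAt (fun r => negEntropy (fwdLaw q r)) (-entropyRate (fwdLaw q t)) t := by
  unfold negEntropy
  have h := HasDerivAt.fun_sum (u := Finset.univ) fun x (_ : x ∈ Finset.univ) =>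
    (hasDerivAt_fwdLaw q t x).fun_mul
      ((hasDerivAt_fwdLaw q t x).log (hq.fwdLaw_pos ht x).ne')
  refine h.congr_deriv ?_
  have h1 : ∀ x, fwdLaw q t x *
      ((∑ i, (avg i (fwdLaw q t) x - fwdLaw q t x)) / fwdLaw q t x) =
      ∑ i, (avg i (fwdLaw q t) x - fwdLaw q t x) := fun x =>
    mul_div_cancel₀ _ (hq.fwdLaw_pos ht x).ne'
  simp only [h1, Finset.sum_add_distrib]
  have h2 : ∑ x, ∑ i, (avg i (fwdLaw q t) x - fwdLaw q t x) = 0 := by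
    rw [Finset.sum_comm]
    simp [Finset.sum_sub_distrib, sum_avg]
  rw [h2, add_zero, entropyRate, ← Finset.sum_neg_distrib]
  simp only [Finset.sum_mul]
  rw [Finset.sum_comm]
  refine Finset.sum_congr rfl fun i _ => ?_
  rw [← Finset.sum_neg_distrib]
  refine Finset.sum_congr rfl fun x _ => ?_
  ring

/-- Mean value theorem; the production rate at the intermediate time is at most the one at the
earlier time `u`. -/
theorem negEntropy_sub_le {q : State d S → ℝ} (hq : IsPMF q) {u h : ℝ} (hu : 0 < u) (hh : 0 < h) :
    negEntropy (fwdLaw q u) - negEntropy (fwdLaw q (u + h)) ≤ h * entropyRate (fwdLaw q u) := by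
  obtain ⟨w, hw, hw'⟩ := exists_hasDerivAt_eq_slope (fun r => negEntropy (fwdLaw q r))
    (fun r => -entropyRate (fwdLaw q r)) (a := u) (b := u + h) (by linarith)
    (fun r hr => (hasDerivAt_negEntropy hq (hu.trans_le hr.1)).continuousAt.continuousWithinAt)
    (fun r hr => hasDerivAt_negEntropy hq (hu.trans hr.1))
  have h1 : entropyRate (fwdLaw q w) ≤ entropyRate (fwdLaw q u) := by
    have := entropyRate_fwdLaw_le (fun x => hq.fwdLaw_pos hu x) (h := w - u) (by linarith [hw.1])
    rwa [← fwdLaw_add, add_sub_cancel] at this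
  rw [add_sub_cancel_left, eq_div_iff hh.ne'] at hw'
  nlinarith

/-- Moving the average onto the logarithm turns each coordinate's contribution into a mean of log
ratios of neighbouring probabilities. -/
theorem entropyRate_le {q : State d S → ℝ} (hq : IsPMF q) {t : ℝ} (ht : 0 < t) :
    entropyRate (fwdLaw q t) ≤ d * Real.log (1 + S / t) := by
  have h1 : ∀ i : Fin d, ∑ x, (fwdLaw q t x - avg i (fwdLaw q t) x) * Real.log (fwdLaw q t x) ≤
      Real.log (1 + S / t) := by
    intro i
    simp only [sub_mul, Finset.sum_sub_distrib, sum_avg_mul]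
    rw [← Finset.sum_sub_distrib]
    calc _ ≤ ∑ x, fwdLaw q t x * Real.log (1 + S / t) := by
          refine Finset.sum_le_sum fun x _ => ?_
          rw [← mul_sub]
          have hx := hq.fwdLaw_pos ht x
          refine mul_le_mul_of_nonneg_left ?_ hx.le
          have hS : (0 : ℝ) < S := by exact_mod_cast (x i).pos
          have h2 : Real.log (fwdLaw q t x) - Real.log (1 + S / t) ≤
              avg i (fun x => Real.log (fwdLaw q t x)) x := by
            rw [avg, le_div_iff₀ hS]
            have h3 : ∑ _a : Fin S, (Real.log (fwdLaw q t x) - Real.log (1 + S / t)) ≤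
                ∑ a, Real.log (fwdLaw q t (Function.update x i a)) := by
              refine Finset.sum_le_sum fun a _ => ?_
              have h4 := Real.log_le_log hx (hq.fwdLaw_le_update ht i x a)
              rw [Real.log_mul (by positivity) (hq.fwdLaw_pos ht _).ne'] at h4
              linarith
            simp only [Finset.sum_const, Finset.card_univ, Fintype.card_fin, nsmul_eq_mul] at h3
            linarith
          linarith
      _ = Real.log (1 + S / t) := by
          rw [← Finset.sum_mul, sum_fwdLaw, hq.2, one_mul]
  calc entropyRate (fwdLaw q t) ≤ ∑ _i : Fin d, Real.log (1 + S / t) :=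
        Finset.sum_le_sum fun i _ => h1 i
    _ = _ := by simp

end entropy

/-! ### The Bregman divergence of the score entropy loss -/

/-- The Bregman divergence between an estimate `r` and a score `s`. -/
def scoreDiv (r s : ℝ) : ℝ := r - s - s * Real.log (r / s)

theorem sq_sqrt_sub_one_le {r : ℝ} (hr : 0 < r) : (√r - 1) ^ 2 ≤ r - 1 - Real.log r := by
  have h1 := Real.log_le_sub_one_of_pos (Real.sqrt_pos.2 hr)
  rw [Real.log_sqrt hr.le] at h1
  nlinarith [Real.sq_sqrt hr.le]

theorem scoreDiv_eq {r s : ℝ} (hs : 0 < s) :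
    scoreDiv r s = s * (r / s - 1 - Real.log (r / s)) := by
  unfold scoreDiv
  field_simp

theorem scoreDiv_nonneg {r s : ℝ} (hr : 0 < r) (hs : 0 < s) : 0 ≤ scoreDiv r s := by
  rw [scoreDiv_eq hs]
  exact mul_nonneg hs.le ((sq_nonneg _).trans (sq_sqrt_sub_one_le (div_pos hr hs)))

/-- Tangent of the logarithm at 2. This trades the estimate for the true score and the loss, without
using `M`. -/
theorem le_add_scoreDiv {r s : ℝ} (hr : 0 < r) (hs : 0 < s) : r ≤ 4 * s + 3 * scoreDiv r s := by
  have h0 : 0 < r / s := div_pos hr hs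
  have h1 := Real.log_le_sub_one_of_pos (show 0 < r / s / 2 by positivity)
  rw [Real.log_div h0.ne' two_ne_zero] at h1
  have h2 := Real.log_two_lt_d9
  have h3 : r = s * (r / s) := by field_simp
  rw [scoreDiv_eq hs]
  nlinarith

/-- Up to 2 the logarithm is paid by 2c; its excess over 2 is at most ρ - 1 - log ρ with ρ = r/s,
which the divergence pays since c ≤ s. -/
theorem mul_log_div_le {r s c : ℝ} (hr : 0 < r) (hs : 0 < s) (hc : 0 ≤ c) (hcs : c ≤ s) :
    c * Real.log (r / s) ≤ 2 * c + scoreDiv r s := by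
  have h0 : 0 < r / s := div_pos hr hs
  have hD := scoreDiv_nonneg hr hs
  rcases le_total (Real.log (r / s)) 2 with h | h
  · nlinarith
  · have h1 := Real.log_le_sub_one_of_pos (show 0 < r / s / 2 by positivity)
    rw [Real.log_div h0.ne' two_ne_zero] at h1
    have h2 := Real.log_two_lt_d9
    rw [scoreDiv_eq hs]
    have h3 : c * (Real.log (r / s) - 2) ≤ s * (Real.log (r / s) - 2) :=
      mul_le_mul_of_nonneg_right hcs (by linarith)
    have h4 : s * (Real.log (r / s) - 2) ≤ s * (r / s - 1 - Real.log (r / s)) :=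
      mul_le_mul_of_nonneg_left (by linarith) hs.le
    linarith

/-- Put w = √(r/s); the divergence D dominates s (w - 1)². If w ≥ 1/2, then s ≤ 4r gives s η ≤ 4A;
Young's inequality bounds (s - r) η by D + s η², and the resulting 5 s η² is at most 5 · 16 A²/s. If
w ≤ 1/2, then D ≥ s/4, and the left side, at most (1/2 + 1) s, is at most 6D. -/
theorem sub_mul_add_sq_le {r s η A : ℝ} (hr : 0 < r) (hs : 0 < s) (hη : 0 ≤ η) (hη' : η ≤ 1 / 2)
    (hA : η * r ≤ A) :
    (s - r) * η + 4 * s * η ^ 2 ≤ 6 * scoreDiv r s + 80 * (A ^ 2 / s) := by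
  have h0 : 0 < r / s := div_pos hr hs
  have hD := scoreDiv_nonneg hr hs
  have hsq := sq_sqrt_sub_one_le h0
  have hDge : s * (√(r / s) - 1) ^ 2 ≤ scoreDiv r s := by
    rw [scoreDiv_eq hs]
    exact mul_le_mul_of_nonneg_left hsq hs.le
  have hrs : r = s * √(r / s) ^ 2 := by
    rw [Real.sq_sqrt h0.le]
    field_simp
  set w := √(r / s) with hw
  have hw0 : 0 ≤ w := Real.sqrt_nonneg _
  have hA0 : 0 ≤ A := (mul_nonneg hη hr.le).trans hA
  have hA2 : 0 ≤ A ^ 2 / s := by positivity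
  rcases le_total (1 / 2) w with h | h
  · have h1 : s * η ≤ 4 * A := by
      have : s * (1 / 4) ≤ r := by
        rw [hrs]
        exact mul_le_mul_of_nonneg_left (by nlinarith) hs.le
      nlinarith
    have h2 : s * η ^ 2 ≤ 16 * (A ^ 2 / s) := by
      rw [mul_div_assoc', le_div_iff₀ hs]
      nlinarith [mul_nonneg hs.le hη]
    have h3 : (s - r) * η ≤ scoreDiv r s + s * η ^ 2 := by
      rcases le_total 1 w with h' | h'
      · have : s ≤ r := by
          rw [hrs]
          exact le_mul_of_one_le_right hs.le (by nlinarith)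
        nlinarith [mul_nonneg hs.le (sq_nonneg η)]
      · have h4 : (s - r) * η ≤ s * ((1 - w) * 2 * η) := by
          have : s - r ≤ s * ((1 - w) * 2) := by rw [hrs]; nlinarith
          nlinarith
        nlinarith [mul_nonneg hs.le (sq_nonneg (1 - w - η))]
    linarith
  · have h1 : s * (1 / 4) ≤ scoreDiv r s := by
      refine le_trans (mul_le_mul_of_nonneg_left ?_ hs.le) hDge
      nlinarith
    have h2 : s * η ≤ s * (1 / 2) := mul_le_mul_of_nonneg_left hη' hs.le
    have h3 : s * η ^ 2 ≤ s * (1 / 4) := mul_le_mul_of_nonneg_left (by nlinarith) hs.le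
    linarith [mul_nonneg hr.le hη]

/-! ### Elementary bounds for the logarithm and the exponential -/

theorem neg_log_one_sub_le {y : ℝ} (hy : y < 1) : -Real.log (1 - y) ≤ y / (1 - y) := by
  have h : 0 < 1 - y := by linarith
  have h1 := Real.one_sub_inv_le_log_of_pos h
  have h2 : y / (1 - y) = (1 - y)⁻¹ - 1 := by field_simp; ring
  linarith

theorem neg_log_one_sub_le_of_le_half {y : ℝ} (hy' : y ≤ 1 / 2) :
    -Real.log (1 - y) ≤ y + 2 * y ^ 2 := by
  refine (neg_log_one_sub_le (by linarith)).trans ?_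
  rw [div_le_iff₀ (by linarith)]
  nlinarith [mul_nonneg (sq_nonneg y) (by linarith : 0 ≤ 1 / 2 - y)]

theorem neg_log_one_sub_le_of_le {y : ℝ} (hy' : y ≤ 3 / 4) :
    -Real.log (1 - y) ≤ y + 4 * y ^ 2 := by
  refine (neg_log_one_sub_le (by linarith)).trans ?_
  rw [div_le_iff₀ (by linarith)]
  nlinarith [mul_nonneg (sq_nonneg y) (by linarith : 0 ≤ 3 / 4 - y)]

theorem exp_sub_one_le {h : ℝ} (h0 : 0 ≤ h) (h1 : h ≤ 1) : Real.exp h - 1 ≤ h + h ^ 2 := by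
  have := Real.abs_exp_sub_one_sub_id_le (x := h) (by rwa [abs_of_nonneg h0])
  have := (abs_le.1 this).2
  linarith

theorem sub_sq_le_one_sub_exp_neg {h : ℝ} (h0 : 0 ≤ h) (h1 : h ≤ 1) :
    h - h ^ 2 ≤ 1 - Real.exp (-h) := by
  have := Real.abs_exp_sub_one_sub_id_le (x := -h) (by rwa [abs_neg, abs_of_nonneg h0])
  have := (abs_le.1 this).2
  nlinarith

theorem one_sub_exp_neg_le (h : ℝ) : 1 - Real.exp (-h) ≤ h := by
  linarith [Real.one_sub_le_exp_neg h]

/-! ### One token in one step -/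

/-- Contribution of a single target token `a` to the divergence of one step. Here `s` is the score,
`r` its estimate, `m` the average score, and `b / S * r * (1 - η)` the probability of a move. -/
theorem move_bound {h b r s η A m : ℝ} (hh : 0 < h) (hh' : h ≤ 1 / 2)
    (hb' : b ≤ h + h ^ 2) (hr : 0 < r) (hs : 0 < s) (hη : 0 ≤ η) (hη' : η ≤ 1 / 2)
    (hA : η * r ≤ A) (hm : 0 ≤ m) (hms : (1 - Real.exp (-h)) * m ≤ s) :
    (Real.exp h - 1) * (s - (1 - Real.exp (-h)) * m) * (-Real.log r - Real.log (1 - η))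
        + b * r * (1 - η) - (1 - Real.exp (-h)) ≤
      h * (s - 1 - s * Real.log s) + 11 * h * scoreDiv r s
        + h ^ 2 * (2 + 5 * s + 2 * m * s + 4 * m) + 80 * h * (A ^ 2 / s) := by
  have hE := exp_sub_one_le hh.le (by linarith)
  have hE' : h ≤ Real.exp h - 1 := by linarith [Real.add_one_le_exp h]
  have he := sub_sq_le_one_sub_exp_neg hh.le (by linarith)
  have he' := one_sub_exp_neg_le h
  have he0 := one_sub_exp_neg_pos hh
  set E := Real.exp h - 1
  set e := 1 - Real.exp (-h)
  set c := e * m with hc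
  have hc0 : 0 ≤ c := mul_nonneg he0.le hm
  have hcm : c ≤ h * m := mul_le_mul_of_nonneg_right he' hm
  set D := scoreDiv r s with hDdef
  have hD : 0 ≤ D := scoreDiv_nonneg hr hs
  have hlog : Real.log (r / s) = Real.log r - Real.log s := Real.log_div hr.ne' hs.ne'
  have hDeq : D = r - s - s * (Real.log r - Real.log s) := by rw [hDdef, scoreDiv, hlog]
  have hslog : s - 1 ≤ s * Real.log s := by
    have := Real.one_sub_inv_le_log_of_pos hs
    have h2 : s * (1 - s⁻¹) = s - 1 := by field_simp
    nlinarith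
  have h1 : -(s * Real.log r) ≤ D + 1 := by linarith
  have h2 : c * Real.log r ≤ c * s + 2 * c + D := by
    have h3 := mul_log_div_le hr hs hc0 hms
    rw [hlog] at h3
    have h4 : c * Real.log s ≤ c * s :=
      mul_le_mul_of_nonneg_left (by linarith [Real.log_le_sub_one_of_pos hs]) hc0
    linarith
  -- Replace `E` by `h` and `c` by 0. Since E - h ≤ h² and c ≤ h m, the errors are of second order
  -- in `h`, apart from multiples of h D.
  have h5 : E * (s - c) * (-Real.log r) ≤
      -(h * (s * Real.log r)) + h ^ 2 * (D + 1) + 2 * h * (c * s + 2 * c + D) := by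
    have h6 : (E - h) * (-(s * Real.log r)) ≤ h ^ 2 * (D + 1) :=
      calc (E - h) * (-(s * Real.log r)) ≤ (E - h) * (D + 1) :=
            mul_le_mul_of_nonneg_left h1 (by linarith)
        _ ≤ h ^ 2 * (D + 1) := mul_le_mul_of_nonneg_right (by linarith) (by linarith)
    have h7 : E * (c * Real.log r) ≤ 2 * h * (c * s + 2 * c + D) :=
      calc E * (c * Real.log r) ≤ E * (c * s + 2 * c + D) :=
            mul_le_mul_of_nonneg_left h2 (by linarith)
        _ ≤ 2 * h * (c * s + 2 * c + D) :=
            mul_le_mul_of_nonneg_right (by nlinarith) (by positivity)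
    linarith
  have h8 : E * (s - c) * (-Real.log (1 - η)) ≤ h * (s * η) + h ^ 2 * s + h * (4 * s * η ^ 2) := by
    have h9 := neg_log_one_sub_le_of_le_half hη'
    have h10 : 0 ≤ -Real.log (1 - η) := by
      linarith [Real.log_nonpos (by linarith : 0 ≤ 1 - η) (by linarith)]
    calc E * (s - c) * (-Real.log (1 - η)) ≤ (h + h ^ 2) * s * (η + 2 * η ^ 2) := by
          gcongr
          linarith
      _ ≤ _ := by
          have : h ^ 2 * s * (η + 2 * η ^ 2) ≤ h ^ 2 * s * 1 + h * s * (2 * η ^ 2) := by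
            nlinarith [mul_nonneg (mul_nonneg hh.le hs.le) (sq_nonneg η),
              mul_nonneg (mul_nonneg (sq_nonneg h) hs.le) (by linarith : 0 ≤ 1 - η)]
          nlinarith
  -- The first order terms s η, from the logarithm, and -r η, from the mass of the move, must be
  -- combined: only the difference s - r is controlled by the score loss.
  have h11 := sub_mul_add_sq_le hr hs hη hη' hA
  have h12 : b * r * (1 - η) ≤ h * r * (1 - η) + h ^ 2 * (4 * s + 3 * D) := by
    have h13 := le_add_scoreDiv hr hs
    have h14 : (b - h) * (r * (1 - η)) ≤ h ^ 2 * (4 * s + 3 * D) := by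
      have : r * (1 - η) ≤ 4 * s + 3 * D := by nlinarith
      exact mul_le_mul (by linarith) this (mul_nonneg hr.le (by linarith)) (by positivity)
    linarith
  have h15 : h * ((s - r) * η + 4 * s * η ^ 2) ≤ h * (6 * D + 80 * (A ^ 2 / s)) :=
    mul_le_mul_of_nonneg_left h11 hh.le
  have h16 : h ^ 2 * D ≤ h * D * (1 / 2) := by nlinarith [mul_nonneg hh.le hD]
  have h17 : h * (c * s + 2 * c) ≤ h ^ 2 * (m * s + 2 * m) := by
    have : h * (c * s + 2 * c) ≤ h * (h * m * s + 2 * (h * m)) := by gcongr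
    linarith
  have h18 : h * D = h * (r - s - s * (Real.log r - Real.log s)) := by rw [← hDeq]
  linarith

/-- The cap y ≤ 1 lets `B`, later a multiple of the score loss, enter linearly rather than squared.
-/
theorem sq_le_of_le_add {y A B : ℝ} (hy0 : 0 ≤ y) (hy1 : y ≤ 1) (hB : 0 ≤ B) (h : y ≤ A + B) :
    y ^ 2 ≤ A ^ 2 + 2 * B := by
  have h1 : y * y ≤ y * (A + B) := mul_le_mul_of_nonneg_left h hy0
  have h2 : y * B ≤ 1 * B := mul_le_mul_of_nonneg_right hy1 hB
  nlinarith [sq_nonneg (y - A)]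

/-- Contribution to the divergence of one step of the event that a token does not change. -/
theorem stay_bound {h e n y W m : ℝ} (hh : 0 ≤ h) (he0 : 0 ≤ e) (he : e ≤ h) (hn0 : 0 ≤ n)
    (hn : n ≤ 1) (hpos : 0 < 1 - e * n) (hy0 : 0 ≤ y) (hy : y ≤ 3 / 4) (hW0 : 0 ≤ W)
    (hW1 : W ≤ 1) (hW : W ≤ 2 * h * m) :
    (1 - W) * Real.log ((1 - e * n) / (1 - y)) ≤
      y + 4 * y ^ 2 - e * n + 2 * h ^ 2 * m := by
  rw [Real.log_div hpos.ne' (by linarith)]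
  have h1 := Real.log_le_sub_one_of_pos hpos
  have h2 := neg_log_one_sub_le_of_le hy
  have h3 : (1 - W) * (Real.log (1 - e * n) - Real.log (1 - y)) ≤
      (1 - W) * (y + 4 * y ^ 2 - e * n) :=
    mul_le_mul_of_nonneg_left (by linarith) (by linarith)
  have h5 : e * n ≤ h * 1 := mul_le_mul he hn hn0 hh
  have h4 : W * (e * n) ≤ 2 * h * m * (h * 1) :=
    mul_le_mul hW h5 (mul_nonneg he0 hn0) (hW0.trans hW)
  have h6 : 0 ≤ W * (y + 4 * y ^ 2) := by positivity
  linarith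

/-- Here `j` is the current token, `Q` the posterior of its predecessor in forward time, and `P` the
sampler's law. Staying contributes about y - e (1 - 1/S), with y the sampler's total moving
probability; this is distributed over the targets and added to their logarithmic terms, which puts
each target in the form of `move_bound`. The constant 59 is 11 from there plus 48 = 4 · 2 · 6 from
4y². -/
theorem token_bound {S : ℕ} (j : Fin S) {s r η P Q : Fin S → ℝ} {h b A κ m : ℝ}
    (hh : 0 < h) (hh' : h ≤ 1 / 2) (hb : h ≤ b) (hb' : b ≤ h + h ^ 2)
    (hr : ∀ a, 0 < r a) (hs : ∀ a, 0 < s a) (hsj : s j = 1)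
    (hη : ∀ a, 0 ≤ η a) (hη' : ∀ a, η a ≤ 1 / 2) (hA : ∀ a, η a * r a ≤ A)
    (hm : m = (∑ a, s a) / S) (hms : ∀ a, (1 - Real.exp (-h)) * m ≤ s a)
    (hP : ∀ a, a ≠ j → P a = b / S * r a * (1 - η a))
    (hPj : P j = 1 - ∑ a ∈ Finset.univ.filter (fun a => a ≠ j), P a)
    (hPle : ∑ a ∈ Finset.univ.filter (fun a => a ≠ j), P a ≤ 3 / 4)
    (hQ : ∀ a, a ≠ j → Q a = (Real.exp h - 1) / S * (s a - (1 - Real.exp (-h)) * m))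
    (hQj : Q j = 1 - ∑ a ∈ Finset.univ.filter (fun a => a ≠ j), Q a) (hQj0 : 0 ≤ Q j)
    (hhκ : h ≤ κ * S) (hmκ : h * m ≤ 2 * (κ * S)) (hAκ : ∀ a, A ^ 2 / s a ≤ κ * S) :
    ∑ a, Q a * Real.log (tokenKernel S h a j / P a) ≤
      h * ((∑ a, (s a - 1 - s a * Real.log (s a))) / S)
        + 59 * h * (∑ a ∈ Finset.univ.filter (fun a => a ≠ j), 1 / S * scoreDiv (r a) (s a))
        + h * (κ * S) * (82 + 527 * m) := by
  have hS : (0 : ℝ) < S := by exact_mod_cast j.pos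
  have hE := exp_sub_one_le hh.le (by linarith)
  have hE' : h ≤ Real.exp h - 1 := by linarith [Real.add_one_le_exp h]
  have he' := one_sub_exp_neg_le h
  have he0 := one_sub_exp_neg_pos hh
  have hmove : ∀ a, _ := fun a =>
    move_bound hh hh' hb' (hr a) (hs a) (hη a) (hη' a) (hA a)
      (m := m) (by rw [hm]; exact div_nonneg (Finset.sum_nonneg fun a _ => (hs a).le) hS.le) (hms a)
  have hm0 : 0 ≤ m := by
    rw [hm]; exact div_nonneg (Finset.sum_nonneg fun a _ => (hs a).le) hS.le
  set E := Real.exp h - 1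
  set e := 1 - Real.exp (-h) with hedef
  set J := Finset.univ.filter (fun a => a ≠ j) with hJ
  have hJj : ∀ a ∈ J, a ≠ j := fun a ha => (Finset.mem_filter.1 ha).2
  have hsplit : ∀ f : Fin S → ℝ, ∑ a, f a = ∑ a ∈ J, f a + f j := by
    intro f
    rw [← Finset.sum_filter_add_sum_filter_not Finset.univ (fun a => a ≠ j)]
    simp [Finset.filter_eq', hJ]
  have hcard : ∑ _a ∈ J, (1 : ℝ) / S = 1 - 1 / S := by
    have := hsplit (fun _ => 1 / S)
    simp [hS.ne'] at this ⊢
    linarith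
  set y := ∑ a ∈ J, P a with hy
  set W := ∑ a ∈ J, Q a with hW
  set D := ∑ a ∈ J, 1 / S * scoreDiv (r a) (s a) with hD
  have hD0 : 0 ≤ D := Finset.sum_nonneg fun a _ =>
    mul_nonneg (by positivity) (scoreDiv_nonneg (hr a) (hs a))
  have hmJ : ∑ a ∈ J, 1 / S * s a ≤ m := by
    have := hsplit s
    rw [hm, this, ← Finset.mul_sum, add_div]
    have : 0 ≤ s j / S := div_nonneg (hs j).le hS.le
    have h2 : 1 / (S : ℝ) * ∑ a ∈ J, s a = (∑ a ∈ J, s a) / S := by ring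
    linarith
  have hy0 : 0 ≤ y := Finset.sum_nonneg fun a ha => by
    rw [hP a (hJj a ha)]
    have h1 := hη' a
    have h2 := hr a
    have : 0 ≤ 1 - η a := by linarith
    have : 0 ≤ b := by linarith
    positivity
  have hW0 : 0 ≤ W := Finset.sum_nonneg fun a ha => by
    rw [hQ a (hJj a ha)]
    exact mul_nonneg (div_nonneg (by linarith) hS.le) (by linarith [hms a])
  have hWle : W ≤ 2 * h * m := by
    calc W ≤ ∑ a ∈ J, 2 * h * (1 / S * s a) := by
          refine Finset.sum_le_sum fun a ha => ?_
          rw [hQ a (hJj a ha)]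
          have h1 : E / S * (s a - e * m) ≤ 2 * h / S * s a :=
            mul_le_mul (div_le_div_of_nonneg_right (by nlinarith) hS.le)
              (by linarith [mul_nonneg he0.le hm0]) (by linarith [hms a]) (by positivity)
          refine h1.trans_eq ?_
          ring
      _ ≤ _ := by
          rw [← Finset.mul_sum]
          exact mul_le_mul_of_nonneg_left hmJ (by positivity)
  have hyle : y ≤ 8 * h * m + 6 * h * D := by
    calc y ≤ ∑ a ∈ J, (8 * h * (1 / S * s a) + 6 * h * (1 / S * scoreDiv (r a) (s a))) := by
          refine Finset.sum_le_sum fun a ha => ?_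
          rw [hP a (hJj a ha)]
          have h1 := le_add_scoreDiv (hr a) (hs a)
          have h2 : b / S * r a * (1 - η a) ≤
              2 * h / S * (4 * s a + 3 * scoreDiv (r a) (s a)) * 1 := by
            have hb2 : b ≤ 2 * h := by nlinarith
            have h3 := hr a
            have h4 := hη a
            have h5 := hη' a
            refine mul_le_mul (mul_le_mul ?_ h1 h3.le ?_) (by linarith) (by linarith) ?_
            · exact div_le_div_of_nonneg_right hb2 hS.le
            · positivity
            · exact mul_nonneg (by positivity) (by linarith)
          refine h2.trans_eq ?_
          ring
      _ ≤ _ := by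
          rw [Finset.sum_add_distrib, hD, Finset.mul_sum (a := 6 * h),
            ← Finset.mul_sum (a := 8 * h)]
          exact add_le_add_left (mul_le_mul_of_nonneg_left hmJ (by positivity)) _
  have hy2 : y ^ 2 ≤ (8 * h * m) ^ 2 + 2 * (6 * h * D) :=
    sq_le_of_le_add hy0 (by linarith) (by positivity) hyle
  have hdiag : Q j * Real.log (tokenKernel S h j j / P j) ≤
      y + 4 * y ^ 2 - e * (1 - 1 / S) + 2 * h ^ 2 * m := by
    have hS1 : (1 : ℝ) / S ≤ 1 := by
      rw [div_le_one hS]; exact_mod_cast j.pos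
    have hS0 : (0 : ℝ) < 1 / S := by positivity
    have hk : tokenKernel S h j j = 1 - e * (1 - 1 / S) := by
      rw [tokenKernel_self, hedef]; ring
    have hkpos := tokenKernel_pos hh j j
    rw [hPj, hk, hQj]
    rw [hk] at hkpos
    exact stay_bound hh.le he0.le he' (by linarith) (by linarith) hkpos hy0 hPle hW0
      (by linarith) hWle
  have hoff : ∀ a ∈ J, Q a * Real.log (tokenKernel S h a j / P a) ≤
      1 / S * (E * (s a - e * m) * (-Real.log (r a) - Real.log (1 - η a))) := by
    intro a ha
    have hη1 : 0 < 1 - η a := by linarith [hη' a]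
    have hb0 : 0 < b := by linarith
    rw [hP a (hJj a ha), tokenKernel_of_ne _ (hJj a ha)]
    have h1 : Real.log ((1 - Real.exp (-h)) / S / (b / S * r a * (1 - η a))) ≤
        -Real.log (r a) - Real.log (1 - η a) := by
      have h2 : (1 - Real.exp (-h)) / S / (b / S * r a * (1 - η a)) =
          e / b / (r a * (1 - η a)) := by
        rw [← hedef]
        field_simp
      have := hr a
      rw [h2, Real.log_div (by positivity) (by positivity),
        Real.log_mul (by positivity) (by positivity)]
      have h3 : Real.log (e / b) ≤ 0 :=
        Real.log_nonpos (by positivity) ((div_le_one hb0).2 (by linarith))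
      linarith
    have hQ0 : 0 ≤ Q a := by
      rw [hQ a (hJj a ha)]
      exact mul_nonneg (div_nonneg (by linarith) hS.le) (by linarith [hms a])
    refine (mul_le_mul_of_nonneg_left h1 hQ0).trans_eq ?_
    rw [hQ a (hJj a ha)]
    ring
  have hycalc : y - e * (1 - 1 / S) = ∑ a ∈ J, 1 / S * (b * r a * (1 - η a) - e) := by
    rw [← hcard, Finset.mul_sum, hy, ← Finset.sum_sub_distrib]
    refine Finset.sum_congr rfl fun a ha => ?_
    rw [hP a (hJj a ha)]
    ring
  have hmain : ∑ a ∈ J, 1 / S * (E * (s a - e * m) * (-Real.log (r a) - Real.log (1 - η a)))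
      + ∑ a ∈ J, 1 / S * (b * r a * (1 - η a) - e) ≤
      h * ((∑ a, (s a - 1 - s a * Real.log (s a))) / S) + 11 * h * D
        + h ^ 2 * (2 + 9 * m + 2 * m ^ 2) + 80 * h * (κ * S) := by
    rw [← Finset.sum_add_distrib]
    have hstep : ∀ a ∈ J, 1 / S * (E * (s a - e * m) * (-Real.log (r a) - Real.log (1 - η a)))
        + 1 / S * (b * r a * (1 - η a) - e) ≤
        h * (1 / S * (s a - 1 - s a * Real.log (s a))) + 11 * h * (1 / S * scoreDiv (r a) (s a))
          + (1 / S * (h ^ 2 * (2 + 4 * m) + 80 * h * (κ * S))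
            + h ^ 2 * (5 + 2 * m) * (1 / S * s a)) := by
      intro a _
      have h1 := hmove a
      have h2 : 80 * h * (A ^ 2 / s a) ≤ 80 * h * (κ * S) :=
        mul_le_mul_of_nonneg_left (hAκ a) (by positivity)
      have h3 : (0 : ℝ) ≤ 1 / S := by positivity
      have h4 := mul_le_mul_of_nonneg_left (h1.trans (add_le_add_right h2 _)) h3
      linarith
    refine (Finset.sum_le_sum hstep).trans ?_
    -- The term a = j vanishes because the score of staying is 1.
    have h0 : ∑ a, (s a - 1 - s a * Real.log (s a)) = ∑ a ∈ J, (s a - 1 - s a * Real.log (s a)) := by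
      rw [hsplit, hsj]
      simp
    have h1 : h ^ 2 * (5 + 2 * m) * ∑ a ∈ J, 1 / S * s a ≤ h ^ 2 * (5 + 2 * m) * m :=
      mul_le_mul_of_nonneg_left hmJ (by positivity)
    have h2 : (1 - 1 / (S : ℝ)) * (h ^ 2 * (2 + 4 * m) + 80 * h * (κ * S)) ≤
        1 * (h ^ 2 * (2 + 4 * m) + 80 * h * (κ * S)) := by
      have : (0 : ℝ) < 1 / S := by positivity
      have : 0 ≤ κ * S := by linarith
      exact mul_le_mul_of_nonneg_right (by linarith) (by positivity)
    have h3 : ∑ a ∈ J, h * (1 / S * (s a - 1 - s a * Real.log (s a))) =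
        h * ((∑ a, (s a - 1 - s a * Real.log (s a))) / S) := by
      rw [h0, Finset.sum_div, Finset.mul_sum]
      exact Finset.sum_congr rfl fun a _ => by ring
    rw [Finset.sum_add_distrib, Finset.sum_add_distrib, Finset.sum_add_distrib, h3,
      ← Finset.sum_mul, hcard, ← Finset.mul_sum (a := 11 * h),
      ← Finset.mul_sum (a := h ^ 2 * (5 + 2 * m)), ← hD]
    linarith
  rw [hsplit]
  have hoffsum := Finset.sum_le_sum hoff
  clear hmove hms hQ hP hη hη' hA hAκ hr hs hoff
  -- One factor of h m is spent on the ratio bound, so that the error is linear in `m`, whose mean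
  -- under the current law is 1.
  have herr : h ^ 2 * (2 + 11 * m + 258 * m ^ 2) ≤ h * (κ * S) * (2 + 527 * m) := by
    have h1 : h * h ≤ h * (κ * S) := mul_le_mul_of_nonneg_left hhκ hh.le
    have h2 : h * h * m ≤ h * (κ * S) * m := mul_le_mul_of_nonneg_right h1 hm0
    have h3 : h * (h * m) * m ≤ h * (2 * (κ * S)) * m :=
      mul_le_mul_of_nonneg_right (mul_le_mul_of_nonneg_left hmκ hh.le) hm0
    linarith
  linarith

section step

variable {d S : ℕ}

/-! ### Coordinate marginals of the reverse transition -/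

/-- A token keeps its value with weight e^{-h} and is otherwise resampled uniformly. Subtracting the
resampled part isolates the initial states with i-th token `b`. -/
theorem fwdLaw_update_eq (q : State d S → ℝ) (h : ℝ) (i : Fin d) (x : State d S) (b : Fin S) :
    fwdLaw q h (Function.update x i b) - (1 - Real.exp (-h)) * avg i (fwdLaw q h) x =
      Real.exp (-h) * ∑ z ∈ Finset.univ.filter (fun z => z i = b), q z * restKernel h i z x := by
  have h1 : avg i (fwdLaw q h) x = (∑ z, q z * restKernel h i z x) / S := by
    simp only [avg, fwdLaw_apply]
    rw [Finset.sum_comm]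
    simp only [← Finset.mul_sum, sum_kernel_update]
  rw [h1, fwdLaw_apply, Finset.sum_filter, Finset.mul_sum, Finset.sum_div, Finset.mul_sum,
    ← Finset.sum_sub_distrib]
  refine Finset.sum_congr rfl fun z _ => ?_
  rw [kernel_update, tokenKernel]
  split_ifs <;> ring

theorem mul_avg_fwdLaw_le {q : State d S → ℝ} (hq : ∀ x, 0 ≤ q x) {h : ℝ} (hh : 0 < h) (i : Fin d)
    (x : State d S) (b : Fin S) :
    (1 - Real.exp (-h)) * avg i (fwdLaw q h) x ≤ fwdLaw q h (Function.update x i b) := by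
  have h1 := fwdLaw_update_eq q h i x b
  have h2 : 0 ≤ Real.exp (-h) *
      ∑ z ∈ Finset.univ.filter (fun z => z i = b), q z * restKernel h i z x :=
    mul_nonneg (Real.exp_pos _).le (Finset.sum_nonneg fun z _ => mul_nonneg (hq z)
      (Finset.prod_nonneg fun _ _ => (tokenKernel_pos hh _ _).le))
  linarith

/-- Joint mass of a final state `x` and an initial state with `i`-th coordinate `a`. -/
def pairMass (q : State d S → ℝ) (h : ℝ) (i : Fin d) (x : State d S) (a : Fin S) : ℝ :=
  ∑ z ∈ Finset.univ.filter (fun z => z i = a), q z * kernel h z x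

/-- Tweedie's formula: after division by the law at `x`, the posterior of one token is a function of
the scores alone. Tweedie τ-leaping is this formula with estimated scores. -/
theorem pairMass_of_ne (q : State d S → ℝ) (h : ℝ) (i : Fin d) (x : State d S) {a : Fin S}
    (ha : a ≠ x i) :
    pairMass q h i x a = (Real.exp h - 1) / S *
      (fwdLaw q h (Function.update x i a) - (1 - Real.exp (-h)) * avg i (fwdLaw q h) x) := by
  rw [fwdLaw_update_eq, pairMass, Finset.mul_sum, Finset.mul_sum]
  refine Finset.sum_congr rfl fun z hz => ?_
  have hz' : z i = a := (Finset.mem_filter.1 hz).2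
  have he : Real.exp h * Real.exp (-h) = 1 := by rw [← Real.exp_add]; simp
  rw [kernel_eq h i, hz', tokenKernel_of_ne h ha]
  linear_combination (-(q z * restKernel h i z x) / S) * he

theorem sum_pairMass_mul (q : State d S → ℝ) (h : ℝ) (i : Fin d) (x : State d S)
    (f : Fin S → ℝ) :
    ∑ a, pairMass q h i x a * f a = ∑ z, q z * kernel h z x * f (z i) := by
  rw [← Finset.sum_fiberwise Finset.univ (fun z : State d S => z i)]
  refine Finset.sum_congr rfl fun a _ => ?_
  rw [pairMass, Finset.sum_mul]
  refine Finset.sum_congr rfl fun z hz => ?_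
  rw [(Finset.mem_filter.1 hz).2]

/-! ### The divergence of one step -/

/-- Averaging preserves total sums, so the terms s - 1 cancel and `q log q` may replace its average.
This is the source of the term -h I(q_{u+h}). -/
theorem sum_mul_score (q : State d S → ℝ) (hq : ∀ x, 0 < q x) (i : Fin d) :
    ∑ x, q x * ((∑ a, (q (Function.update x i a) / q x - 1 -
        q (Function.update x i a) / q x * Real.log (q (Function.update x i a) / q x))) / S) =
      -∑ x, (q x - avg i q x) * Real.log (q x) := by
  have h1 : ∀ x, q x * ((∑ a, (q (Function.update x i a) / q x - 1 -
        q (Function.update x i a) / q x * Real.log (q (Function.update x i a) / q x))) / S) =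
      avg i q x - q x - avg i (fun x => q x * Real.log (q x)) x + avg i q x * Real.log (q x) := by
    intro x
    have hx := hq x
    have hS : (S : ℝ) ≠ 0 := by
      have := (x i).pos
      positivity
    have h2 : avg i q x - q x = avg i q x - (∑ _a : Fin S, q x) / S := by
      simp [mul_div_cancel_left₀ _ hS]
    rw [h2]
    simp only [avg]
    rw [div_mul_eq_mul_div, Finset.sum_mul, ← sub_div, ← sub_div, ← add_div, mul_div_assoc',
      Finset.mul_sum, ← Finset.sum_sub_distrib, ← Finset.sum_sub_distrib, ← Finset.sum_add_distrib]
    congr 1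
    refine Finset.sum_congr rfl fun a _ => ?_
    rw [Real.log_div (hq _).ne' hx.ne']
    field_simp
    ring
  rw [Finset.sum_congr rfl fun x _ => h1 x]
  simp only [Finset.sum_add_distrib, Finset.sum_sub_distrib, sum_avg, sub_mul]
  ring

theorem scoreEntropy_eq (q₀ : State d S → ℝ) (t : ℝ) (s : State d S → State d S → ℝ) :
    scoreEntropy q₀ t s = ∑ i, ∑ x, fwdLaw q₀ t x *
      ∑ a ∈ Finset.univ.filter (fun a => a ≠ x i), 1 / S *
        scoreDiv (s (Function.update x i a) x)
          (fwdLaw q₀ t (Function.update x i a) / fwdLaw q₀ t x) := by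
  rw [Finset.sum_comm, scoreEntropy]
  refine Finset.sum_congr rfl fun x _ => ?_
  rw [← Finset.mul_sum]
  congr 1
  exact sum_fwdRate_mul_of_ne (fun y => scoreDiv (s y x) (fwdLaw q₀ t y / fwdLaw q₀ t x)) x

theorem scoreEntropy_nonneg {q₀ : State d S → ℝ} (hq : IsPMF q₀) {t : ℝ} (ht : 0 < t)
    {s : State d S → State d S → ℝ} (hs : ∀ y x, 0 < s y x) : 0 ≤ scoreEntropy q₀ t s := by
  rw [scoreEntropy_eq]
  exact Finset.sum_nonneg fun i _ => Finset.sum_nonneg fun x _ =>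
    mul_nonneg (hq.fwdLaw_pos ht x).le (Finset.sum_nonneg fun a _ => mul_nonneg (by positivity)
      (scoreDiv_nonneg (hs _ _) (div_pos (hq.fwdLaw_pos ht _) (hq.fwdLaw_pos ht _))))

/-- Coordinate laws that move token `i` of `x` to `a` with probability
`b / S * s (x ⊕ᵢ a) x * (1 - η)`, for a small relative perturbation `η`. -/
structure IsPerturbedStep (s : State d S → State d S → ℝ) (b A : ℝ)
    (P : State d S → Fin d → Fin S → ℝ) : Prop where
  exists_move : ∀ x i, ∃ η : Fin S → ℝ, (∀ a, 0 ≤ η a) ∧ (∀ a, η a ≤ 1 / 2) ∧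
    (∀ a, η a * s (Function.update x i a) x ≤ A) ∧
    ∀ a, a ≠ x i → P x i a = b / S * s (Function.update x i a) x * (1 - η a)
  stay : ∀ x i, P x i (x i) = 1 - ∑ a ∈ Finset.univ.filter (fun a => a ≠ x i), P x i a
  move_le : ∀ x i, ∑ a ∈ Finset.univ.filter (fun a => a ≠ x i), P x i a ≤ 3 / 4

theorem IsPerturbedStep.pos {s : State d S → State d S → ℝ} {b A : ℝ}
    {P : State d S → Fin d → Fin S → ℝ} (hP : IsPerturbedStep s b A P) (hb : 0 < b)
    (hs : ∀ y x, 0 < s y x) (x : State d S) (i : Fin d) (a : Fin S) : 0 < P x i a := by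
  by_cases ha : a = x i
  · rw [ha, hP.stay]
    linarith [hP.move_le x i]
  · obtain ⟨η, h0, h1, -, h3⟩ := hP.exists_move x i
    rw [h3 a ha]
    have hS : (0 : ℝ) < S := by exact_mod_cast a.pos
    have : 0 < 1 - η a := by linarith [h1 a]
    have := hs (Function.update x i a) x
    positivity

theorem IsPerturbedStep.isPMF {s : State d S → State d S → ℝ} {b A : ℝ}
    {P : State d S → Fin d → Fin S → ℝ} (hP : IsPerturbedStep s b A P) (hb : 0 < b)
    (hs : ∀ y x, 0 < s y x) (x : State d S) (i : Fin d) : IsPMF (P x i) := by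
  refine ⟨fun a => (hP.pos hb hs x i a).le, ?_⟩
  rw [← Finset.sum_filter_add_sum_filter_not Finset.univ (fun a => a ≠ x i)]
  simp [Finset.filter_eq', hP.stay x i]

theorem token_step_bound {q₀ : State d S → ℝ} (hq : IsPMF q₀) {u h b A κ : ℝ} (hu : 0 < u)
    (hh : 0 < h) (hh' : h ≤ 1 / 2) (hb : h ≤ b) (hb' : b ≤ h + h ^ 2)
    (hκ : h ≤ κ * min 1 (u + h)) (hA : 2 * A ^ 2 ≤ h * min 1 (u + h))
    {s : State d S → State d S → ℝ} (hs : ∀ y x, 0 < s y x)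
    {P : State d S → Fin d → Fin S → ℝ} (hP : IsPerturbedStep s b A P) (x : State d S)
    (i : Fin d) :
    ∑ z, fwdLaw q₀ u z * kernel h z x * Real.log (tokenKernel S h (z i) (x i) / P x i (z i)) ≤
      fwdLaw q₀ (u + h) x * (h * ((∑ a, (fwdLaw q₀ (u + h) (Function.update x i a) /
            fwdLaw q₀ (u + h) x - 1 -
          fwdLaw q₀ (u + h) (Function.update x i a) / fwdLaw q₀ (u + h) x *
            Real.log (fwdLaw q₀ (u + h) (Function.update x i a) / fwdLaw q₀ (u + h) x))) / S)
        + 59 * h * (∑ a ∈ Finset.univ.filter (fun a => a ≠ x i), 1 / S *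
          scoreDiv (s (Function.update x i a) x)
            (fwdLaw q₀ (u + h) (Function.update x i a) / fwdLaw q₀ (u + h) x))
        + h * (κ * S) * (82 + 527 * (avg i (fwdLaw q₀ (u + h)) x / fwdLaw q₀ (u + h) x))) := by
  have hv : 0 < u + h := by linarith
  have hS : (0 : ℝ) < S := by exact_mod_cast (x i).pos
  have hS1 : (1 : ℝ) ≤ S := by exact_mod_cast (x i).pos
  have hpos := fun y => hq.fwdLaw_pos hv y
  have hadd := fwdLaw_add q₀ u h
  have hqx := hpos x
  have hκ0 : 0 < κ := by
    by_contra! hneg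
    have : 0 < min 1 (u + h) := lt_min one_pos hv
    nlinarith
  have hκ1 : h ≤ κ := hκ.trans (mul_le_of_le_one_right hκ0.le (min_le_left _ _))
  have hκv : h ≤ κ * (u + h) := hκ.trans (mul_le_mul_of_nonneg_left (min_le_right _ _) hκ0.le)
  obtain ⟨η, hη0, hη1, hηA, hPη⟩ := hP.exists_move x i
  have hQsum : ∑ a, pairMass (fwdLaw q₀ u) h i x a = fwdLaw q₀ (u + h) x := by
    have := sum_pairMass_mul (fwdLaw q₀ u) h i x (fun _ => 1)
    simp only [mul_one] at this
    rw [this, hadd, fwdLaw_apply]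
  rw [← sum_pairMass_mul (fwdLaw q₀ u) h i x
    (fun a => Real.log (tokenKernel S h a (x i) / P x i a))]
  have key := token_bound (x i) (s := fun a =>
      fwdLaw q₀ (u + h) (Function.update x i a) / fwdLaw q₀ (u + h) x)
    (r := fun a => s (Function.update x i a) x) (η := η) (P := P x i)
    (Q := fun a => pairMass (fwdLaw q₀ u) h i x a / fwdLaw q₀ (u + h) x) (A := A) (κ := κ)
    (m := avg i (fwdLaw q₀ (u + h)) x / fwdLaw q₀ (u + h) x)
    hh hh' hb hb' (fun a => hs _ _) (fun a => div_pos (hpos _) hqx) ?_ hη0 hη1 hηA ?_ ?_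
    hPη (hP.stay x i) (hP.move_le x i) ?_ ?_ ?_ ?_ ?_ ?_
  · refine le_trans (le_of_eq ?_) (mul_le_mul_of_nonneg_left key hqx.le)
    rw [Finset.mul_sum]
    refine Finset.sum_congr rfl fun a _ => ?_
    field_simp
  · simp [div_self hqx.ne']
  · simp only [avg, ← Finset.sum_div]
    rw [div_right_comm]
  · intro a
    rw [mul_div_assoc']
    refine div_le_div_of_nonneg_right ?_ hqx.le
    rw [hadd]
    exact mul_avg_fwdLaw_le (fun y => (hq.fwdLaw_pos hu y).le) hh i x a
  · intro a ha
    rw [pairMass_of_ne _ _ _ _ ha, ← hadd]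
    field_simp
  · rw [eq_sub_iff_add_eq, ← Finset.sum_div, ← add_div, div_eq_one_iff_eq hqx.ne', ← hQsum,
      ← Finset.sum_filter_add_sum_filter_not Finset.univ (fun a => a ≠ x i)
        (fun a => pairMass (fwdLaw q₀ u) h i x a)]
    simp [Finset.filter_eq', add_comm]
  · exact div_nonneg (Finset.sum_nonneg fun z _ =>
      mul_nonneg (hq.fwdLaw_pos hu z).le (kernel_pos hh z x).le) hqx.le
  · nlinarith
  · have h1 : avg i (fwdLaw q₀ (u + h)) x / fwdLaw q₀ (u + h) x ≤ 1 + S / (u + h) := by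
      rw [div_le_iff₀ hqx, avg, div_le_iff₀ hS]
      calc _ ≤ ∑ _a : Fin S, (1 + S / (u + h)) * fwdLaw q₀ (u + h) x :=
            Finset.sum_le_sum fun a _ => hq.fwdLaw_update_le hv i x a
        _ = _ := by simp; ring
    have h2 : h * (S / (u + h)) ≤ κ * S := by
      rw [mul_div_assoc', div_le_iff₀ hv]
      nlinarith
    nlinarith
  · intro a
    have h1 := hq.fwdLaw_le_update hv i x a
    have h2 : A ^ 2 * (1 + S / (u + h)) ≤ κ * S := by
      have h3 : 2 * A ^ 2 ≤ h * 1 :=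
        hA.trans (mul_le_mul_of_nonneg_left (min_le_left _ _) hh.le)
      have h4 : 2 * A ^ 2 ≤ h * (u + h) :=
        hA.trans (mul_le_mul_of_nonneg_left (min_le_right _ _) hh.le)
      have h5 : 2 * (A ^ 2 * (S / (u + h))) ≤ h * S := by
        rw [mul_div_assoc', mul_div_assoc', div_le_iff₀ hv]
        nlinarith
      nlinarith
    rw [div_div_eq_mul_div, div_le_iff₀ (hpos _)]
    calc A ^ 2 * fwdLaw q₀ (u + h) x
        ≤ A ^ 2 * ((1 + S / (u + h)) * fwdLaw q₀ (u + h) (Function.update x i a)) :=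
          mul_le_mul_of_nonneg_left h1 (sq_nonneg A)
      _ = A ^ 2 * (1 + S / (u + h)) * fwdLaw q₀ (u + h) (Function.update x i a) := by ring
      _ ≤ _ := mul_le_mul_of_nonneg_right h2 (hpos _).le

/-- The product form of both kernels splits the logarithm into entropies and single token terms. The
constant is 609 = 82 + 527, as the average scores have mean 1. -/
theorem step_bound {q₀ : State d S → ℝ} (hq : IsPMF q₀) {u h b A κ : ℝ} (hu : 0 < u)
    (hh : 0 < h) (hh' : h ≤ 1 / 2) (hb : h ≤ b) (hb' : b ≤ h + h ^ 2)
    (hκ : h ≤ κ * min 1 (u + h)) (hA : 2 * A ^ 2 ≤ h * min 1 (u + h))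
    {s : State d S → State d S → ℝ} (hs : ∀ y x, 0 < s y x)
    {P : State d S → Fin d → Fin S → ℝ} (hP : IsPerturbedStep s b A P) :
    ∑ x, ∑ z, fwdLaw q₀ u z * kernel h z x *
        Real.log (fwdLaw q₀ u z * kernel h z x / (fwdLaw q₀ (u + h) x * ∏ i, P x i (z i))) ≤
      h * (entropyRate (fwdLaw q₀ u) - entropyRate (fwdLaw q₀ (u + h)))
        + 59 * (h * scoreEntropy q₀ (u + h) s) + 609 * (h * (κ * S * d)) := by
  have hv : 0 < u + h := by linarith
  have hposu := fun y => hq.fwdLaw_pos hu y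
  have hpos := fun y => hq.fwdLaw_pos hv y
  have hPpos := hP.pos (hh.trans_le hb) hs
  have hlog : ∀ x z, fwdLaw q₀ u z * kernel h z x *
      Real.log (fwdLaw q₀ u z * kernel h z x / (fwdLaw q₀ (u + h) x * ∏ i, P x i (z i))) =
      fwdLaw q₀ u z * Real.log (fwdLaw q₀ u z) * kernel h z x
        - fwdLaw q₀ u z * kernel h z x * Real.log (fwdLaw q₀ (u + h) x)
        + ∑ i, fwdLaw q₀ u z * kernel h z x *
          Real.log (tokenKernel S h (z i) (x i) / P x i (z i)) := by
    intro x z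
    have hprod : kernel h z x / ∏ i, P x i (z i) =
        ∏ i, tokenKernel S h (z i) (x i) / P x i (z i) := by
      rw [kernel, Finset.prod_div_distrib]
    have hPP : 0 < ∏ i, P x i (z i) := Finset.prod_pos fun i _ => hPpos x i _
    rw [mul_div_mul_comm, hprod, Real.log_mul (div_pos (hposu z) (hpos x)).ne'
      (Finset.prod_pos fun i _ => div_pos (tokenKernel_pos hh _ _) (hPpos x i _)).ne',
      Real.log_prod (fun i _ => (div_pos (tokenKernel_pos hh _ _) (hPpos x i _)).ne'),
      Real.log_div (hposu z).ne' (hpos x).ne', ← Finset.mul_sum]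
    ring
  simp only [hlog, Finset.sum_add_distrib, Finset.sum_sub_distrib]
  have h1 : ∑ x, ∑ z, fwdLaw q₀ u z * Real.log (fwdLaw q₀ u z) * kernel h z x =
      negEntropy (fwdLaw q₀ u) := by
    rw [Finset.sum_comm]
    simp only [← Finset.mul_sum, sum_kernel, mul_one]
    rfl
  have h2 : ∑ x, ∑ z, fwdLaw q₀ u z * kernel h z x * Real.log (fwdLaw q₀ (u + h) x) =
      negEntropy (fwdLaw q₀ (u + h)) := by
    refine Finset.sum_congr rfl fun x _ => ?_
    rw [← Finset.sum_mul, ← fwdLaw_apply, ← fwdLaw_add]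
  have h3 := negEntropy_sub_le hq hu hh
  have h4 : ∑ x, ∑ z, ∑ i, fwdLaw q₀ u z * kernel h z x *
      Real.log (tokenKernel S h (z i) (x i) / P x i (z i)) ≤
      -(h * entropyRate (fwdLaw q₀ (u + h))) + 59 * (h * scoreEntropy q₀ (u + h) s)
        + 609 * (h * (κ * S * d)) := by
    calc _ = ∑ i, ∑ x, ∑ z, fwdLaw q₀ u z * kernel h z x *
          Real.log (tokenKernel S h (z i) (x i) / P x i (z i)) := by
          rw [Finset.sum_comm (s := Finset.univ (α := Fin d))]
          exact Finset.sum_congr rfl fun x _ => Finset.sum_comm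
      _ ≤ ∑ i, ∑ x, _ := Finset.sum_le_sum fun i _ => Finset.sum_le_sum fun x _ =>
          token_step_bound hq hu hh hh' hb hb' hκ hA hs hP x i
      _ = ∑ i, (h * (-∑ x, (fwdLaw q₀ (u + h) x - avg i (fwdLaw q₀ (u + h)) x) *
              Real.log (fwdLaw q₀ (u + h) x)) + 59 * h * (∑ x, fwdLaw q₀ (u + h) x *
            ∑ a ∈ Finset.univ.filter (fun a => a ≠ x i), 1 / S *
              scoreDiv (s (Function.update x i a) x)
                (fwdLaw q₀ (u + h) (Function.update x i a) / fwdLaw q₀ (u + h) x))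
            + h * (κ * S) * 609) := by
          refine Finset.sum_congr rfl fun i _ => ?_
          rw [← sum_mul_score _ hpos i]
          have h5 : (609 : ℝ) = ∑ x, (82 * fwdLaw q₀ (u + h) x + 527 * avg i (fwdLaw q₀ (u + h)) x) := by
            rw [Finset.sum_add_distrib, ← Finset.mul_sum, ← Finset.mul_sum, sum_avg, sum_fwdLaw,
              hq.2]
            norm_num
          rw [h5, Finset.mul_sum, Finset.mul_sum, Finset.mul_sum, ← Finset.sum_add_distrib,
            ← Finset.sum_add_distrib]
          refine Finset.sum_congr rfl fun x _ => ?_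
          have h6 : fwdLaw q₀ (u + h) x * (avg i (fwdLaw q₀ (u + h)) x / fwdLaw q₀ (u + h) x) =
              avg i (fwdLaw q₀ (u + h)) x := mul_div_cancel₀ _ (hpos x).ne'
          linear_combination (h * (κ * S) * 527) * h6
      _ = _ := by
          rw [Finset.sum_add_distrib, Finset.sum_add_distrib, ← Finset.mul_sum, ← Finset.mul_sum,
            scoreEntropy_eq, Finset.sum_neg_distrib, entropyRate]
          simp
          ring
  rw [h1, h2]
  linarith

end step

section divergence

variable {d S : ℕ}

/-! ### Kullback-Leibler divergence -/

/-- The Kullback-Leibler divergence of positive mass functions, as a sum. -/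
def klSum (q p : State d S → ℝ) : ℝ := ∑ x, q x * Real.log (q x / p x)

theorem toMeasure_singleton (p : State d S → ℝ) (x : State d S) :
    toMeasure p {x} = ENNReal.ofReal (p x) := by
  rw [toMeasure, MeasureTheory.Measure.finsetSum_apply, Finset.sum_eq_single x]
  · simp
  · intro y _ hy
    simp [hy]
  · simp

instance (p : State d S → ℝ) : MeasureTheory.IsFiniteMeasure (toMeasure p) := by
  refine ⟨?_⟩
  rw [toMeasure, MeasureTheory.Measure.finsetSum_apply]
  simp [ENNReal.sum_lt_top]

theorem toMeasure_univ {p : State d S → ℝ} (hp : IsPMF p) : (toMeasure p).real Set.univ = 1 := by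
  rw [MeasureTheory.measureReal_def, toMeasure, MeasureTheory.Measure.finsetSum_apply]
  simp only [MeasureTheory.Measure.smul_apply, MeasureTheory.measure_univ, smul_eq_mul, mul_one]
  rw [← ENNReal.ofReal_sum_of_nonneg fun x _ => hp.1 x, hp.2]
  simp

theorem toMeasure_eq_withDensity (q : State d S → ℝ) {p : State d S → ℝ} (hp : ∀ x, 0 < p x) :
    toMeasure q = (toMeasure p).withDensity (fun x => ENNReal.ofReal (q x / p x)) := by
  refine MeasureTheory.Measure.ext_of_singleton fun x => ?_
  rw [MeasureTheory.withDensity_apply _ (MeasurableSet.singleton x),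
    MeasureTheory.lintegral_singleton, toMeasure_singleton, toMeasure_singleton,
    ← ENNReal.ofReal_mul' (hp x).le, div_mul_cancel₀ _ (hp x).ne']

theorem KL_eq {q p : State d S → ℝ} (hq : ∀ x, 0 < q x) (hp : ∀ x, 0 < p x) (hq1 : IsPMF q)
    (hp1 : IsPMF p) : KL q p = ENNReal.ofReal (klSum q p) := by
  have hac : (toMeasure q).AbsolutelyContinuous (toMeasure p) := by
    rw [toMeasure_eq_withDensity q hp]
    exact MeasureTheory.withDensity_absolutelyContinuous _ _
  have hrn : ∀ x, (toMeasure q).rnDeriv (toMeasure p) x = ENNReal.ofReal (q x / p x) := by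
    have h1 := MeasureTheory.Measure.rnDeriv_withDensity (toMeasure p)
      (f := fun x => ENNReal.ofReal (q x / p x)) (measurable_of_countable _)
    rw [← toMeasure_eq_withDensity q hp] at h1
    intro x
    -- Every point has positive mass, so the almost everywhere identity holds everywhere.
    by_contra hne
    have h2 : toMeasure p {x} = 0 := MeasureTheory.measure_mono_null
      (Set.singleton_subset_iff.2 hne) (MeasureTheory.ae_iff.1 h1)
    rw [toMeasure_singleton, ENNReal.ofReal_eq_zero] at h2
    exact absurd (hp x) h2.not_gt
  rw [KL, InformationTheory.klDiv_of_ac_of_integrable hac .of_finite, toMeasure_univ hq1,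
    toMeasure_univ hp1, MeasureTheory.integral_fintype .of_finite]
  congr 1
  rw [add_sub_cancel_right, klSum]
  refine Finset.sum_congr rfl fun x _ => ?_
  rw [MeasureTheory.measureReal_def, toMeasure_singleton, ENNReal.toReal_ofReal (hq x).le,
    smul_eq_mul, MeasureTheory.llr, hrn, ENNReal.toReal_ofReal (div_pos (hq x) (hp x)).le]

/-- The chain rule and data processing inequality for one step of a sampler. -/
theorem klSum_step_le {q₀ : State d S → ℝ} (hq : IsPMF q₀) {u h : ℝ} (hu : 0 < u) (hh : 0 < h)
    {p : State d S → ℝ} (hp : ∀ x, 0 < p x) {P : State d S → Fin d → Fin S → ℝ}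
    (hP : ∀ x i a, 0 < P x i a) :
    klSum (fwdLaw q₀ u) (fun z => ∑ x, p x * ∏ i, P x i (z i)) ≤
      klSum (fwdLaw q₀ (u + h)) p + ∑ x, ∑ z, fwdLaw q₀ u z * kernel h z x *
        Real.log (fwdLaw q₀ u z * kernel h z x /
          (fwdLaw q₀ (u + h) x * ∏ i, P x i (z i))) := by
  have hposu := fun y => hq.fwdLaw_pos hu y
  have hpos := fun y => hq.fwdLaw_pos (by linarith : 0 < u + h) y
  have hPP : ∀ x z : State d S, 0 < ∏ i, P x i (z i) := fun x z =>
    Finset.prod_pos fun i _ => hP x i _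
  have h1 : klSum (fwdLaw q₀ (u + h)) p =
      ∑ x, ∑ z, fwdLaw q₀ u z * kernel h z x * Real.log (fwdLaw q₀ (u + h) x / p x) := by
    refine Finset.sum_congr rfl fun x _ => ?_
    rw [← Finset.sum_mul, ← fwdLaw_apply, ← fwdLaw_add]
  rw [h1, ← Finset.sum_add_distrib]
  simp only [← Finset.sum_add_distrib]
  rw [Finset.sum_comm]
  refine Finset.sum_le_sum fun z _ => ?_
  have h2 := log_sum_inequality Finset.univ (a := fun x => fwdLaw q₀ u z * kernel h z x)
    (b := fun x => p x * ∏ i, P x i (z i))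
    (fun x _ => mul_pos (hposu z) (kernel_pos hh z x)) (fun x _ => mul_pos (hp x) (hPP x z))
  rw [← Finset.mul_sum, sum_kernel, mul_one] at h2
  refine h2.trans_eq (Finset.sum_congr rfl fun x _ => ?_)
  have hk := kernel_pos hh z x
  rw [← mul_add, ← Real.log_mul (div_pos (hpos x) (hp x)).ne'
    (div_pos (mul_pos (hposu z) hk) (mul_pos (hpos x) (hPP x z))).ne']
  congr 2
  have := (hpos x).ne'
  have := (hp x).ne'
  have := (hPP x z).ne'
  field_simp

/-! ### Initialization -/

theorem sum_kernel_mul (t : ℝ) (z : State d S) (i : Fin d) (g : Fin S → ℝ) :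
    ∑ x : State d S, kernel t z x * g (x i) = ∑ a, tokenKernel S t (z i) a * g a := by
  have h := Finset.prod_univ_sum (fun _ : Fin d => (Finset.univ : Finset (Fin S)))
    (fun j a => tokenKernel S t (z j) a * (if j = i then g a else 1))
  rw [Fintype.piFinset_univ, ← Finset.mul_prod_erase _ _ (Finset.mem_univ i)] at h
  simp only [if_true, Finset.prod_mul_distrib, Finset.prod_ite_eq', Finset.mem_univ] at h
  rw [Finset.prod_eq_one] at h
  · rw [mul_one] at h
    exact h.symm
  · intro j hj
    simp [Finset.ne_of_mem_erase hj, sum_tokenKernel]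

/-- Off the diagonal S times the kernel is below 1, so these terms are nonpositive. On the diagonal
it is a convex combination of S and 1, and x log x is convex. -/
theorem sum_tokenKernel_mul_log_le {t : ℝ} (ht : 0 < t) (c : Fin S) :
    ∑ a, tokenKernel S t c a * Real.log (S * tokenKernel S t c a) ≤
      Real.exp (-t) * Real.log S := by
  have hS : (0 : ℝ) < S := by exact_mod_cast c.pos
  have hp := Real.exp_pos (-t)
  have hp1 := one_sub_exp_neg_pos ht
  rw [← Finset.add_sum_erase _ _ (Finset.mem_univ c)]
  have h1 : ∑ a ∈ Finset.univ.erase c,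
      tokenKernel S t c a * Real.log (S * tokenKernel S t c a) ≤ 0 := by
    refine Finset.sum_nonpos fun a ha => ?_
    refine mul_nonpos_of_nonneg_of_nonpos (tokenKernel_pos ht c a).le ?_
    rw [tokenKernel_of_ne t (Finset.ne_of_mem_erase ha).symm, mul_div_cancel₀ _ hS.ne']
    exact Real.log_nonpos hp1.le (by linarith)
  have h2 := Real.convexOn_mul_log.2 (Set.mem_Ici.2 hS.le) (Set.mem_Ici.2 zero_le_one) hp.le hp1.le
    (by ring)
  simp only [smul_eq_mul, Real.log_one, mul_zero, mul_one, add_zero] at h2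
  have h3 : S * tokenKernel S t c c = Real.exp (-t) * S + (1 - Real.exp (-t)) := by
    rw [tokenKernel_self]
    field_simp
  rw [← h3] at h2
  have h4 : tokenKernel S t c c * Real.log (S * tokenKernel S t c c) ≤
      Real.exp (-t) * Real.log S := by
    refine le_of_mul_le_mul_left ?_ hS
    linarith
  linarith

/-- Convexity of x log x reduces to deterministic initial states, for which the divergence is a sum
over coordinates. -/
theorem klSum_uniform_le {q₀ : State d S → ℝ} (hq : IsPMF q₀) {t : ℝ} (ht : 0 < t) (hS : 0 < S) :
    klSum (fwdLaw q₀ t) (fun _ => 1 / (S : ℝ) ^ d) ≤ d * Real.log S * Real.exp (-t) := by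
  have hS' : (0 : ℝ) < S := by exact_mod_cast hS
  have hSd : (0 : ℝ) < (S : ℝ) ^ d := by positivity
  have h1 : ∀ x, fwdLaw q₀ t x * Real.log (fwdLaw q₀ t x / (1 / (S : ℝ) ^ d)) ≤
      ∑ z, q₀ z * (kernel t z x * Real.log ((S : ℝ) ^ d * kernel t z x)) := by
    intro x
    have h2 := Real.convexOn_mul_log.map_sum_le (t := Finset.univ) (w := q₀)
      (p := fun z => (S : ℝ) ^ d * kernel t z x) (fun z _ => hq.1 z) hq.2
      (fun z _ => Set.mem_Ici.2 (mul_pos hSd (kernel_pos ht z x)).le)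
    simp only [smul_eq_mul] at h2
    have h3 : ∑ z, q₀ z * ((S : ℝ) ^ d * kernel t z x) = (S : ℝ) ^ d * fwdLaw q₀ t x := by
      rw [fwdLaw_apply, Finset.mul_sum]
      exact Finset.sum_congr rfl fun z _ => by ring
    rw [h3] at h2
    refine le_of_mul_le_mul_left ?_ hSd
    rw [div_div_eq_mul_div, div_one, mul_comm (fwdLaw q₀ t x) ((S : ℝ) ^ d), ← mul_assoc,
      Finset.mul_sum]
    refine h2.trans_eq (Finset.sum_congr rfl fun z _ => ?_)
    ring
  have h4 : ∀ z : State d S, ∑ x, kernel t z x * Real.log ((S : ℝ) ^ d * kernel t z x) ≤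
      d * (Real.exp (-t) * Real.log S) := by
    intro z
    have h5 : ∀ x : State d S, kernel t z x * Real.log ((S : ℝ) ^ d * kernel t z x) =
        ∑ i, kernel t z x * Real.log (S * tokenKernel S t (z i) (x i)) := by
      intro x
      rw [← Finset.mul_sum, ← Real.log_prod
        (fun i _ => (mul_pos hS' (tokenKernel_pos ht _ _)).ne'), Finset.prod_mul_distrib]
      simp [kernel]
    simp only [h5]
    rw [Finset.sum_comm]
    calc _ ≤ ∑ _i : Fin d, Real.exp (-t) * Real.log S := by
          refine Finset.sum_le_sum fun i _ => ?_
          rw [sum_kernel_mul t z i (fun a => Real.log (S * tokenKernel S t (z i) a))]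
          exact sum_tokenKernel_mul_log_le ht (z i)
      _ = _ := by simp
  calc _ ≤ ∑ x, ∑ z, q₀ z * (kernel t z x * Real.log ((S : ℝ) ^ d * kernel t z x)) :=
        Finset.sum_le_sum fun x _ => h1 x
    _ = ∑ z, q₀ z * ∑ x, kernel t z x * Real.log ((S : ℝ) ^ d * kernel t z x) := by
        rw [Finset.sum_comm]
        simp only [Finset.mul_sum]
    _ ≤ ∑ z, q₀ z * (d * (Real.exp (-t) * Real.log S)) :=
        Finset.sum_le_sum fun z _ => mul_le_mul_of_nonneg_left (h4 z) (hq.1 z)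
    _ = _ := by rw [← Finset.sum_mul, hq.2]; ring

/-! ### Early stopping -/

/-- With probability at least e^{-dδ} ≥ 1 - dδ no token is resampled, so the positive part of q₀ -
q_δ is at most dδ q₀; both laws have the same total mass. -/
theorem TV_fwdLaw_le {q₀ : State d S → ℝ} (hq : IsPMF q₀) {δ : ℝ} (hδ : 0 < δ) :
    TV q₀ (fwdLaw q₀ δ) ≤ d * δ := by
  have h1 : ∀ x, (1 - d * δ) * q₀ x ≤ fwdLaw q₀ δ x := by
    intro x
    have hk : 1 - d * δ ≤ kernel δ x x :=
      calc 1 - d * δ ≤ Real.exp (-(d * δ)) := Real.one_sub_le_exp_neg _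
        _ = ∏ _i : Fin d, Real.exp (-δ) := by
            rw [Finset.prod_const, ← Real.exp_nat_mul]
            simp
        _ ≤ kernel δ x x := by
            refine Finset.prod_le_prod (fun _ _ => (Real.exp_pos _).le) fun i _ => ?_
            rw [tokenKernel_self]
            have := one_sub_exp_neg_pos hδ
            have : 0 ≤ (1 - Real.exp (-δ)) / S := by positivity
            linarith
    calc (1 - d * δ) * q₀ x ≤ q₀ x * kernel δ x x := by
          rw [mul_comm]
          exact mul_le_mul_of_nonneg_left hk (hq.1 x)
      _ ≤ fwdLaw q₀ δ x := by
          rw [fwdLaw_apply]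
          exact Finset.single_le_sum (f := fun z => q₀ z * kernel δ z x)
            (fun z _ => mul_nonneg (hq.1 z) (kernel_pos hδ z x).le) (Finset.mem_univ x)
  have h2 : ∀ x, |q₀ x - fwdLaw q₀ δ x| ≤ 2 * (d * δ) * q₀ x - (q₀ x - fwdLaw q₀ δ x) := by
    intro x
    have h3 := h1 x
    have h4 : 0 ≤ (d * δ) * q₀ x := mul_nonneg (by positivity) (hq.1 x)
    rw [abs_le]
    constructor <;> linarith
  have h5 := Finset.sum_le_sum fun x (_ : x ∈ Finset.univ) => h2 x
  rw [Finset.sum_sub_distrib, Finset.sum_sub_distrib, sum_fwdLaw, ← Finset.mul_sum, hq.2] at h5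
  unfold TV
  linarith

end divergence

/-! ### Euler and Tweedie steps -/

section samplers

variable {d S : ℕ}

theorem sum_filter_div_le {j : Fin S} {r : Fin S → ℝ} {B : ℝ} (hr : ∀ a, r a ≤ B) (hB : 0 ≤ B) :
    ∑ a ∈ Finset.univ.filter (fun a => a ≠ j), r a / S ≤ B := by
  have hS : (0 : ℝ) < S := by exact_mod_cast j.pos
  calc _ ≤ ∑ _a ∈ Finset.univ.filter (fun a => a ≠ j), B / S :=
        Finset.sum_le_sum fun a _ => div_le_div_of_nonneg_right (hr a) hS.le
    _ ≤ ∑ _a : Fin S, B / S := Finset.sum_le_sum_of_subset_of_nonneg (Finset.filter_subset _ _)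
        fun _ _ _ => by positivity
    _ = B := by
        simp
        field_simp

theorem isPerturbedStep_euler {s : State d S → State d S → ℝ} {h M : ℝ} (hh : 0 < h)
    (hM : 1 ≤ M) (hs : ∀ y x, s y x ∈ Set.Icc M⁻¹ M) (hhM : h * M ≤ 1 / 2) :
    IsPerturbedStep s h 0 (eulerToken s h) := by
  have hmove : ∀ x i a, a ≠ x i → eulerToken s h x i a = h / S * s (Function.update x i a) x := by
    intro x i a ha
    rw [eulerToken, if_neg ha, tokenRate, fwdRate_update x ha]
    ring
  refine ⟨fun x i => ⟨fun _ => 0, by simp, by norm_num, by simp, fun a ha => ?_⟩, ?_, ?_⟩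
  · rw [hmove x i a ha]
    ring
  · intro x i
    rw [eulerToken, if_pos rfl, neg_mul, ← sub_eq_add_neg, Finset.sum_mul]
    congr 1
    refine Finset.sum_congr rfl fun a ha => ?_
    rw [eulerToken, if_neg (Finset.mem_filter.1 ha).2]
  · intro x i
    have h1 := sum_filter_div_le (j := x i) (r := fun a => h * s (Function.update x i a) x)
      (B := h * M) (fun a => mul_le_mul_of_nonneg_left (hs _ _).2 hh.le) (by positivity)
    refine (le_of_eq ?_).trans (h1.trans (by linarith))
    refine Finset.sum_congr rfl fun a ha => ?_
    rw [hmove x i a (Finset.mem_filter.1 ha).2]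
    ring

/-- The relative correction η is (1 - e^{-h}) times the mean estimate over the estimate at the
target, hence at most h M · M. This is where `M ^ 2` comes from. -/
theorem isPerturbedStep_tweedie {s : State d S → State d S → ℝ} {h M : ℝ} (hh : 0 < h)
    (hM : 1 ≤ M) (hs : ∀ y x, s y x ∈ Set.Icc M⁻¹ M) (hhM : h * M ^ 2 ≤ 1 / 2) :
    IsPerturbedStep s (Real.exp h - 1) (h * M) (tweedieToken s h) := by
  have hM0 : 0 < M := by linarith
  have hs0 : ∀ y x, 0 < s y x := fun y x => (inv_pos.2 hM0).trans_le (hs y x).1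
  have hhM1 : h * M ≤ 1 / 2 := by nlinarith
  have hh1 : h ≤ 1 / 2 := by nlinarith
  have he' := one_sub_exp_neg_le h
  have he0 := one_sub_exp_neg_pos hh
  have hE := exp_sub_one_le hh.le (by linarith)
  have hexp : Real.exp h * Real.exp (-h) = 1 := by rw [← Real.exp_add]; simp
  have hmove : ∀ x i a, a ≠ x i → tweedieMove s h x i a =
      (Real.exp h - 1) / S * (s (Function.update x i a) x -
        (1 - Real.exp (-h)) * ((∑ c, s (Function.update x i c) x) / S)) := by
    intro x i a ha
    have h1 : ∑ c, tokenKernel S (-h) a c * s (Function.update x i c) x =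
        Real.exp h * s (Function.update x i a) x +
          (1 - Real.exp h) * ((∑ c, s (Function.update x i c) x) / S) := by
      simp only [tokenKernel, neg_neg, add_mul, Finset.sum_add_distrib, ← Finset.mul_sum]
      simp
      ring
    simp only [tweedieMove, exp_smul_Rbase]
    rw [h1, tokenKernel_of_ne h ha]
    linear_combination (-(s (Function.update x i a) x) / S) * hexp
  have havg : ∀ x i, (∑ c, s (Function.update x i c) x) / S ≤ M ∧
      0 ≤ (∑ c, s (Function.update x i c) x) / S := by
    intro x i
    have hS : (0 : ℝ) < S := by exact_mod_cast (x i).pos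
    refine ⟨?_, div_nonneg (Finset.sum_nonneg fun c _ => (hs0 _ _).le) hS.le⟩
    rw [div_le_iff₀ hS]
    calc _ ≤ ∑ _c : Fin S, M := Finset.sum_le_sum fun c _ => (hs _ _).2
      _ = _ := by simp [mul_comm]
  have hηA : ∀ x i, (1 - Real.exp (-h)) * ((∑ c, s (Function.update x i c) x) / S) ≤ h * M :=
    fun x i => mul_le_mul he' (havg x i).1 (havg x i).2 hh.le
  refine ⟨fun x i => ⟨fun a => (1 - Real.exp (-h)) * ((∑ c, s (Function.update x i c) x) / S) /
    s (Function.update x i a) x, fun a => ?_, fun a => ?_, fun a => ?_, fun a ha => ?_⟩, ?_, ?_⟩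
  · exact div_nonneg (mul_nonneg he0.le (havg x i).2) (hs0 _ _).le
  · rw [div_le_iff₀ (hs0 _ _)]
    refine (hηA x i).trans ?_
    have h1 : h * M = h * M ^ 2 * M⁻¹ := by field_simp
    rw [h1]
    exact mul_le_mul hhM (hs _ _).1 (inv_pos.2 hM0).le (by norm_num)
  · rw [div_mul_cancel₀ _ (hs0 _ _).ne']
    exact hηA x i
  · rw [tweedieToken, if_neg ha, hmove x i a ha]
    have := (hs0 (Function.update x i a) x).ne'
    field_simp
  · intro x i
    rw [tweedieToken, if_pos rfl]
    congr 1
    refine Finset.sum_congr rfl fun a ha => ?_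
    rw [tweedieToken, if_neg (Finset.mem_filter.1 ha).2]
  · intro x i
    have hE0 : 0 ≤ Real.exp h - 1 := by linarith [Real.add_one_le_exp h]
    have h1 := sum_filter_div_le (j := x i) (r := fun a => (Real.exp h - 1) *
        (s (Function.update x i a) x -
          (1 - Real.exp (-h)) * ((∑ c, s (Function.update x i c) x) / S)))
      (B := (Real.exp h - 1) * M) (fun a => mul_le_mul_of_nonneg_left (by
        linarith [(hs (Function.update x i a) x).2, mul_nonneg he0.le (havg x i).2]) hE0)
      (by positivity)
    have h2 : (Real.exp h - 1) * M ≤ 3 / 4 := by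
      have : (Real.exp h - 1) * M ≤ (h + h ^ 2) * M := mul_le_mul_of_nonneg_right hE hM0.le
      nlinarith
    refine (le_of_eq ?_).trans (h1.trans h2)
    refine Finset.sum_congr rfl fun a ha => ?_
    rw [tweedieToken, if_neg (Finset.mem_filter.1 ha).2, hmove x i a (Finset.mem_filter.1 ha).2]
    ring

end samplers

/-! ### Error of the samplers on a grid -/

section grid

variable {d S : ℕ}

theorem samplerLaw_pos {P : ℕ → State d S → Fin d → Fin S → ℝ} (hS : 0 < S) {N : ℕ}
    (hP : ∀ k < N, ∀ x i a, 0 < P k x i a) : ∀ k ≤ N, ∀ x, 0 < samplerLaw P k x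
  | 0, _, x => by
    have : (0 : ℝ) < S := by exact_mod_cast hS
    simp only [samplerLaw]
    positivity
  | k + 1, hk, x => Finset.sum_pos (fun y _ => mul_pos (samplerLaw_pos hS hP k (by omega) y)
      (Finset.prod_pos fun i _ => hP k (by omega) y i _)) ⟨x, Finset.mem_univ x⟩

theorem sum_samplerLaw {P : ℕ → State d S → Fin d → Fin S → ℝ} (hS : 0 < S) {N : ℕ}
    (hP : ∀ k < N, ∀ x i, IsPMF (P k x i)) : ∀ k ≤ N, ∑ x, samplerLaw P k x = 1
  | 0, _ => by
    have : (S : ℝ) ≠ 0 := by positivity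
    simp [samplerLaw, this]
  | k + 1, hk => by
    simp only [samplerLaw]
    rw [Finset.sum_comm, ← sum_samplerLaw hS hP k (by omega)]
    refine Finset.sum_congr rfl fun x _ => ?_
    have h := Finset.prod_univ_sum (fun _ : Fin d => (Finset.univ : Finset (Fin S))) (P k x)
    rw [Fintype.piFinset_univ, Finset.prod_eq_one fun i _ => (hP k (by omega) x i).2] at h
    rw [← Finset.mul_sum, ← h, mul_one]

theorem IsGrid.le {T δ : ℝ} {N : ℕ} {t : ℕ → ℝ} (ht : IsGrid T δ N t) {k : ℕ} (hk : k ≤ N) :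
    t k ≤ T - δ := by
  rw [← ht.2.1]
  exact Nat.decreasingInduction' (P := fun k => t k ≤ t N)
    (fun j hj _ ih => (ht.2.2 j hj).le.trans ih) hk le_rfl

theorem ScoreError.nonneg {q₀ : State d S → ℝ} (hq : IsPMF q₀) {T δ M ε : ℝ} {N : ℕ} {t : ℕ → ℝ}
    {s : ℝ → State d S → State d S → ℝ} (hδ : 0 < δ) (hM : 1 ≤ M) (ht : IsGrid T δ N t)
    (hε : ScoreError q₀ T N t s ε) (hs : ScoreBounded T N t s M) : 0 ≤ ε := by
  refine le_trans (Finset.sum_nonneg fun k hk => ?_) hε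
  have hk' := Finset.mem_range.1 hk
  refine mul_nonneg (by linarith [ht.2.2 k hk']) (scoreEntropy_nonneg hq ?_ fun y x =>
    (inv_pos.2 (by linarith : 0 < M)).trans_le (hs k hk' y x).1)
  linarith [ht.le hk'.le]

/-- Divergence of a sampler whose steps are perturbed Euler steps. -/
theorem klSum_samplerLaw_le {q₀ : State d S → ℝ} (hq : IsPMF q₀) (hS : 0 < S) {T δ κ : ℝ} {N : ℕ}
    {t : ℕ → ℝ} {s : ℝ → State d S → State d S → ℝ} (hδ : 0 < δ)
    (hκ0 : 0 < κ) (hκ1 : κ ≤ 1 / 2) (ht : IsGrid T δ N t)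
    (hκ : ∀ k < N, t (k + 1) - t k ≤ κ * min 1 (T - t k))
    (hs : ∀ k < N, ∀ y x, 0 < s (T - t k) y x)
    {P : ℕ → State d S → Fin d → Fin S → ℝ} {b A : ℕ → ℝ}
    (hb : ∀ k < N, t (k + 1) - t k ≤ b k)
    (hb' : ∀ k < N, b k ≤ (t (k + 1) - t k) + (t (k + 1) - t k) ^ 2)
    (hA : ∀ k < N, 2 * A k ^ 2 ≤ (t (k + 1) - t k) * min 1 (T - t k))
    (hP : ∀ k < N, IsPerturbedStep (s (T - t k)) (b k) (A k) (P k)) :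
    ∀ k ≤ N, klSum (fwdLaw q₀ (T - t k)) (samplerLaw P k) ≤
      d * Real.log S * Real.exp (-T)
        + κ * (entropyRate (fwdLaw q₀ (T - t k)) - entropyRate (fwdLaw q₀ T))
        + 59 * ∑ j ∈ Finset.range k, (t (j + 1) - t j) * scoreEntropy q₀ (T - t j) (s (T - t j))
        + 609 * (t k * (κ * S * d)) := by
  have hstep0 : ∀ k < N, 0 < t (k + 1) - t k := fun k hk => by linarith [ht.2.2 k hk]
  have hPpos : ∀ k < N, ∀ x i a, 0 < P k x i a := fun k hk =>
    (hP k hk).pos ((hstep0 k hk).trans_le (hb k hk)) (hs k hk)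
  have hT : 0 < T := by linarith [ht.le (Nat.zero_le N), ht.1]
  intro k
  induction k with
  | zero =>
    intro _
    simp only [ht.1, sub_zero, sub_self, mul_zero, Finset.range_zero, Finset.sum_empty, zero_mul,
      add_zero]
    exact klSum_uniform_le hq hT hS
  | succ k ih =>
    intro hk
    have hkN : k < N := by omega
    have hu : 0 < T - t (k + 1) := by linarith [ht.le hk]
    have hh := hstep0 k hkN
    have hhκ : t (k + 1) - t k ≤ κ :=
      (hκ k hkN).trans (mul_le_of_le_one_right hκ0.le (min_le_left _ _))
    have hv : T - t (k + 1) + (t (k + 1) - t k) = T - t k := by ring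
    have h1 := klSum_step_le hq hu hh (samplerLaw_pos hS hPpos k (by omega)) (hPpos k hkN)
    have h2 := step_bound hq hu hh (by linarith) (hb k hkN) (hb' k hkN)
      (κ := κ) (by rw [hv]; exact hκ k hkN) (by rw [hv]; exact hA k hkN)
      (s := s (T - t k)) (hs k hkN) (hP k hkN)
    have h3 := entropyRate_fwdLaw_le (fun x => hq.fwdLaw_pos hu x) hh
    rw [← fwdLaw_add, hv] at h3
    rw [hv] at h1 h2
    -- The entropy production is larger at the smaller forward time, so the step size may be
    -- replaced by the uniform bound κ, after which the differences telescope.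
    have h4 : (t (k + 1) - t k) *
        (entropyRate (fwdLaw q₀ (T - t (k + 1))) - entropyRate (fwdLaw q₀ (T - t k))) ≤
        κ * (entropyRate (fwdLaw q₀ (T - t (k + 1))) - entropyRate (fwdLaw q₀ (T - t k))) :=
      mul_le_mul_of_nonneg_right hhκ (by linarith)
    have h5 := ih (by omega)
    rw [Finset.sum_range_succ]
    have h6 : klSum (fwdLaw q₀ (T - t (k + 1))) (samplerLaw P (k + 1)) =
      klSum (fwdLaw q₀ (T - t (k + 1)))
        (fun z => ∑ x, samplerLaw P k x * ∏ i, P k x i (z i)) := rfl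
    rw [h6]
    linarith

/-- From δ < T follows T - log δ ≥ T - log T ≥ 1; tangents of the logarithm give the rest. -/
theorem time_add_log_bounds {T δ M : ℝ} {S : ℕ} (hS : 0 < S) (hδ : 0 < δ) (hδT : δ < T) (hM : 1 ≤ M) :
    1 ≤ T + Real.log (M * S * δ⁻¹) ∧ T ≤ 2 * (T + Real.log (M * S * δ⁻¹)) ∧
      Real.log (1 + S / δ) ≤ 2 * (T + Real.log (M * S * δ⁻¹)) ∧
      T - Real.log δ ≤ T + Real.log (M * S * δ⁻¹) := by
  have hS' : (1 : ℝ) ≤ S := by exact_mod_cast hS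
  have hS0 : (0 : ℝ) < S := by linarith
  have hM0 : 0 < M := by linarith
  have hT : 0 < T := hδ.trans hδT
  have hlog : Real.log (M * S * δ⁻¹) = Real.log M + Real.log S - Real.log δ := by
    rw [Real.log_mul (by positivity) (by positivity), Real.log_mul hM0.ne' hS0.ne', Real.log_inv]
    ring
  have h1 := Real.log_nonneg hM
  have h2 := Real.log_nonneg hS'
  have h3 := Real.log_le_log hδ hδT.le
  have h4 := Real.log_le_sub_one_of_pos hT
  have h5 := Real.log_le_sub_one_of_pos (show 0 < T / 2 by positivity)
  rw [Real.log_div hT.ne' two_ne_zero] at h5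
  have h6 := Real.log_two_lt_d9
  rw [hlog]
  refine ⟨by linarith, by linarith, ?_, by linarith⟩
  rcases le_total δ S with h | h
  · have h7 : 1 + S / δ ≤ 2 * (S / δ) := by
      have := (one_le_div hδ).2 h
      linarith
    have h8 := Real.log_le_log (by positivity) h7
    rw [Real.log_mul two_ne_zero (by positivity), Real.log_div hS0.ne' hδ.ne'] at h8
    linarith
  · have h7 : 1 + S / δ ≤ 2 := by
      have := (div_le_one hδ).2 h
      linarith
    have h8 := Real.log_le_log (by positivity) h7
    linarith

theorem samplesWithin_of_isPerturbedStep {q₀ : State d S → ℝ} (hq : IsPMF q₀) (hd : 0 < d)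
    (hS : 0 < S) {T δ κ M ε : ℝ} {N : ℕ}
    {t : ℕ → ℝ} {s : ℝ → State d S → State d S → ℝ} (hδ : 0 < δ) (hδT : δ < T) (hM : 1 ≤ M)
    (hκ0 : 0 < κ) (hκ1 : κ ≤ 1 / 2) (ht : IsGrid T δ N t)
    (hκ : ∀ k < N, t (k + 1) - t k ≤ κ * min 1 (T - t k))
    (hε : ScoreError q₀ T N t s ε) (hs : ScoreBounded T N t s M)
    {P : ℕ → State d S → Fin d → Fin S → ℝ} {b A : ℕ → ℝ}
    (hb : ∀ k < N, t (k + 1) - t k ≤ b k)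
    (hb' : ∀ k < N, b k ≤ (t (k + 1) - t k) + (t (k + 1) - t k) ^ 2)
    (hA : ∀ k < N, 2 * A k ^ 2 ≤ (t (k + 1) - t k) * min 1 (T - t k))
    (hP : ∀ k < N, IsPerturbedStep (s (T - t k)) (b k) (A k) (P k)) :
    SamplesWithin P N (fwdLaw q₀ δ) (1220 * (d * Real.log S * Real.exp (-T) + ε
      + κ * d ^ 2 * S * (T + Real.log (M * S * δ⁻¹)))) := by
  have hM0 : 0 < M := by linarith
  have hs0 : ∀ k < N, ∀ y x, 0 < s (T - t k) y x := fun k hk y x =>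
    (inv_pos.2 hM0).trans_le (hs k hk y x).1
  have hstep0 : ∀ k < N, 0 < t (k + 1) - t k := fun k hk => by linarith [ht.2.2 k hk]
  have hPpos : ∀ k < N, ∀ x i a, 0 < P k x i a := fun k hk =>
    (hP k hk).pos ((hstep0 k hk).trans_le (hb k hk)) (hs0 k hk)
  have hPpmf : ∀ k < N, ∀ x i, IsPMF (P k x i) := fun k hk =>
    (hP k hk).isPMF ((hstep0 k hk).trans_le (hb k hk)) (hs0 k hk)
  have hlawpos := samplerLaw_pos hS hPpos N le_rfl
  refine ⟨hPpmf, ?_⟩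
  rw [KL_eq (fun x => hq.fwdLaw_pos hδ x) hlawpos (hq.fwdLaw hδ)
    ⟨fun x => (hlawpos x).le, sum_samplerLaw hS hPpmf N le_rfl⟩]
  refine ENNReal.ofReal_le_ofReal ?_
  have h1 := klSum_samplerLaw_le hq hS hδ hκ0 hκ1 ht hκ hs0 hb hb' hA hP N le_rfl
  rw [ht.2.1, sub_sub_cancel] at h1
  have h2 := entropyRate_le hq hδ
  have h3 := entropyRate_nonneg (fun x => hq.fwdLaw_pos (hδ.trans hδT) x)
  have hε0 := hε.nonneg hq hδ hM ht hs
  obtain ⟨h4, h5, h6, -⟩ := time_add_log_bounds hS hδ hδT hM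
  set L := T + Real.log (M * S * δ⁻¹)
  have hS' : (1 : ℝ) ≤ S := by exact_mod_cast hS
  have hd' : (1 : ℝ) ≤ d := by exact_mod_cast hd
  -- This and `h8` give the constant 1220 = 2 + 2 · 609.
  have h7 : κ * (entropyRate (fwdLaw q₀ δ) - entropyRate (fwdLaw q₀ T)) ≤
      2 * (κ * d ^ 2 * S * L) := by
    calc κ * (entropyRate (fwdLaw q₀ δ) - entropyRate (fwdLaw q₀ T))
        ≤ κ * (d * (2 * L)) := by
          refine mul_le_mul_of_nonneg_left ?_ hκ0.le
          have : d * Real.log (1 + S / δ) ≤ d * (2 * L) :=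
            mul_le_mul_of_nonneg_left h6 (by linarith)
          linarith
      _ = 2 * (κ * (d * 1) * 1 * L) := by ring
      _ ≤ 2 * (κ * (d * d) * S * L) := by gcongr
      _ = _ := by ring
  have h8 : (T - δ) * (κ * S * d) ≤ 2 * (κ * d ^ 2 * S * L) := by
    calc (T - δ) * (κ * S * d) ≤ 2 * L * (κ * S * d) :=
          mul_le_mul_of_nonneg_right (by linarith) (by positivity)
      _ = 2 * (κ * (d * 1) * S * L) := by ring
      _ ≤ 2 * (κ * (d * d) * S * L) := by gcongr
      _ = _ := by ring
  have h9 : 0 ≤ d * Real.log S * Real.exp (-T) := by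
    have := Real.log_nonneg hS'
    positivity
  have h10 : _ ≤ ε := hε
  linarith

theorem samplesWithin_euler {q₀ : State d S → ℝ} (hq : IsPMF q₀) (hd : 0 < d)
    (hS : 0 < S) {T δ κ M ε : ℝ} {N : ℕ}
    {t : ℕ → ℝ} {s : ℝ → State d S → State d S → ℝ} (hδ : 0 < δ) (hδT : δ < T) (hM : 1 ≤ M)
    (hκ0 : 0 < κ) (ht : IsGrid T δ N t)
    (hκ : ∀ k < N, t (k + 1) - t k ≤ κ * min 1 (T - t k))
    (hε : ScoreError q₀ T N t s ε) (hs : ScoreBounded T N t s M) (hκM : κ * M ≤ 1 / 2) :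
    SamplesWithin (eulerStep T t s) N (fwdLaw q₀ δ)
      (1220 * (d * Real.log S * Real.exp (-T) + ε
        + κ * d ^ 2 * S * (T + Real.log (M * S * δ⁻¹)))) := by
  have hstep0 : ∀ k < N, 0 < t (k + 1) - t k := fun k hk => by linarith [ht.2.2 k hk]
  refine samplesWithin_of_isPerturbedStep hq hd hS hδ hδT hM hκ0 (by nlinarith) ht hκ hε hs
    (b := fun k => t (k + 1) - t k) (A := fun _ => 0) (fun _ _ => le_rfl)
    (fun k _ => le_add_of_nonneg_right (sq_nonneg _)) (fun k hk => ?_) (fun k hk => ?_)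
  · have : 0 ≤ min 1 (T - t k) := le_min zero_le_one (by linarith [ht.le hk.le])
    simpa using mul_nonneg (hstep0 k hk).le this
  · refine isPerturbedStep_euler (hstep0 k hk) hM (hs k hk) ?_
    have : t (k + 1) - t k ≤ κ :=
      (hκ k hk).trans (mul_le_of_le_one_right hκ0.le (min_le_left _ _))
    nlinarith

theorem samplesWithin_tweedie {q₀ : State d S → ℝ} (hq : IsPMF q₀) (hd : 0 < d)
    (hS : 0 < S) {T δ κ M ε : ℝ} {N : ℕ}
    {t : ℕ → ℝ} {s : ℝ → State d S → State d S → ℝ} (hδ : 0 < δ) (hδT : δ < T) (hM : 1 ≤ M)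
    (hκ0 : 0 < κ) (ht : IsGrid T δ N t)
    (hκ : ∀ k < N, t (k + 1) - t k ≤ κ * min 1 (T - t k))
    (hε : ScoreError q₀ T N t s ε) (hs : ScoreBounded T N t s M) (hκM : κ * M ^ 2 ≤ 1 / 2) :
    SamplesWithin (tweedieStep T t s) N (fwdLaw q₀ δ)
      (1220 * (d * Real.log S * Real.exp (-T) + ε
        + κ * d ^ 2 * S * (T + Real.log (M * S * δ⁻¹)))) := by
  have hstep0 : ∀ k < N, 0 < t (k + 1) - t k := fun k hk => by linarith [ht.2.2 k hk]
  have hM2 : 1 ≤ M ^ 2 := one_le_pow₀ hM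
  have hκ1 : κ ≤ 1 / 2 := by nlinarith
  have hle : ∀ k < N, t (k + 1) - t k ≤ κ := fun k hk =>
    (hκ k hk).trans (mul_le_of_le_one_right hκ0.le (min_le_left _ _))
  refine samplesWithin_of_isPerturbedStep hq hd hS hδ hδT hM hκ0 hκ1 ht hκ hε hs
    (b := fun k => Real.exp (t (k + 1) - t k) - 1) (A := fun k => (t (k + 1) - t k) * M)
    (fun k _ => by linarith [Real.add_one_le_exp (t (k + 1) - t k)])
    (fun k hk => exp_sub_one_le (hstep0 k hk).le (by linarith [hle k hk]))
    (fun k hk => ?_) (fun k hk => ?_)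
  · have hm : 0 ≤ min 1 (T - t k) := le_min zero_le_one (by linarith [ht.le hk.le])
    have h1 := hκ k hk
    have h2 := hstep0 k hk
    calc 2 * ((t (k + 1) - t k) * M) ^ 2 = (t (k + 1) - t k) * (2 * M ^ 2 * (t (k + 1) - t k)) := by
          ring
      _ ≤ (t (k + 1) - t k) * (2 * M ^ 2 * (κ * min 1 (T - t k))) := by gcongr
      _ = (t (k + 1) - t k) * (2 * (κ * M ^ 2) * min 1 (T - t k)) := by ring
      _ ≤ (t (k + 1) - t k) * (1 * min 1 (T - t k)) := by
          gcongr
          linarith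
      _ = _ := by ring
  · refine isPerturbedStep_tweedie (hstep0 k hk) hM (hs k hk) ?_
    nlinarith [hle k hk]

theorem SamplesWithin.mono {P : ℕ → State d S → Fin d → Fin S → ℝ} {N : ℕ} {q : State d S → ℝ}
    {B B' : ℝ} (h : SamplesWithin P N q B) (hB : B ≤ B') : SamplesWithin P N q B' :=
  ⟨h.1, h.2.trans (ENNReal.ofReal_le_ofReal hB)⟩

end grid

/-! ### Grids with exponentially decaying step sizes -/

/-- Remaining time after `k` steps of relative size `κ`, starting from `T`. -/
def remaining (T κ : ℝ) : ℕ → ℝ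
  | 0 => T
  | k + 1 => remaining T κ k - κ * min 1 (remaining T κ k)

theorem continuous_remaining (T : ℝ) (k : ℕ) : Continuous fun κ => remaining T κ k := by
  induction k with
  | zero => exact continuous_const
  | succ k ih => exact ih.sub (continuous_id.mul (continuous_const.min ih))

theorem remaining_zero (T : ℝ) (k : ℕ) : remaining T 0 k = T := by
  induction k with
  | zero => rfl
  | succ k ih => simp [remaining, ih]

theorem remaining_pos {T κ : ℝ} (hT : 0 < T) (hκ0 : 0 ≤ κ) (hκ1 : κ < 1) (k : ℕ) :
    0 < remaining T κ k := by
  induction k with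
  | zero => exact hT
  | succ k ih =>
    have h1 : κ * min 1 (remaining T κ k) ≤ κ * remaining T κ k :=
      mul_le_mul_of_nonneg_left (min_le_right _ _) hκ0
    simp only [remaining]
    nlinarith

/-- Number of steps still to be made, in units of `1 / κ`, up to a constant. -/
def potential (v : ℝ) : ℝ := if 1 ≤ v then v - 1 else Real.log v

theorem potential_le {v : ℝ} (hv : 0 < v) : potential v ≤ v - 1 := by
  unfold potential
  split_ifs
  · exact le_rfl
  · exact Real.log_le_sub_one_of_pos hv

theorem log_le_potential {v : ℝ} (hv : 0 < v) : Real.log v ≤ potential v := by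
  unfold potential
  split_ifs
  · exact Real.log_le_sub_one_of_pos hv
  · exact le_rfl

/-- Above 1 a step subtracts κ; below 1 it multiplies by 1 - κ, and log(1 - κ) ≤ -κ. A step across 1
is covered by log v ≤ v - 1. -/
theorem potential_step_le {v κ : ℝ} (hv : 0 < v) (hκ0 : 0 ≤ κ) (hκ1 : κ < 1) :
    potential (v - κ * min 1 v) ≤ potential v - κ := by
  rcases le_or_gt 1 v with h | h
  · rw [min_eq_left h, mul_one]
    refine (potential_le (by linarith)).trans ?_
    rw [potential, if_pos h]
    linarith
  · rw [min_eq_right h.le]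
    have h1 : v - κ * v = v * (1 - κ) := by ring
    have h2 : v * (1 - κ) < 1 := by nlinarith
    rw [h1, potential, potential, if_neg h2.not_ge, if_neg h.not_ge,
      Real.log_mul hv.ne' (by linarith)]
    linarith [Real.log_le_sub_one_of_pos (by linarith : 0 < 1 - κ)]

theorem log_remaining_le {T κ : ℝ} (hT : 0 < T) (hκ0 : 0 ≤ κ) (hκ1 : κ < 1) (k : ℕ) :
    Real.log (remaining T κ k) ≤ T - k * κ := by
  refine (log_le_potential (remaining_pos hT hκ0 hκ1 k)).trans ?_
  induction k with
  | zero =>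
    have := potential_le hT
    simp only [remaining, Nat.cast_zero, zero_mul]
    linarith
  | succ k ih =>
    have := potential_step_le (remaining_pos hT hκ0 hκ1 k) hκ0 hκ1
    simp only [remaining]
    push_cast
    linarith

/-- The time remaining after exactly `N` steps is continuous in κ, equals `T` at 0 and is at most δ
at κ₁, so some κ in between hits δ. -/
theorem exists_grid {T δ κ₁ : ℝ} {N : ℕ} (hδ : 0 < δ) (hδT : δ < T) (hκ0 : 0 ≤ κ₁) (hκ1 : κ₁ < 1)
    (hN : T - Real.log δ ≤ N * κ₁) :
    ∃ (κ : ℝ) (t : ℕ → ℝ), 0 < κ ∧ κ ≤ κ₁ ∧ IsGrid T δ N t ∧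
      ∀ k < N, t (k + 1) - t k = κ * min 1 (T - t k) := by
  have hT : 0 < T := hδ.trans hδT
  have h1 : remaining T κ₁ N ≤ δ := by
    have h2 := log_remaining_le hT hκ0 hκ1 N
    exact (Real.log_le_log_iff (remaining_pos hT hκ0 hκ1 N) hδ).1 (by linarith)
  obtain ⟨κ, ⟨h3, h4⟩, h5⟩ := intermediate_value_Icc' hκ0
    (continuous_remaining T N).continuousOn (show δ ∈ Set.Icc _ _ from
      ⟨h1, by rw [remaining_zero]; exact hδT.le⟩)
  simp only at h5
  have h6 : 0 < κ := by
    refine h3.lt_of_ne ?_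
    rintro rfl
    rw [remaining_zero] at h5
    linarith
  have hpos := remaining_pos hT h3 (h4.trans_lt hκ1)
  refine ⟨κ, fun k => T - remaining T κ k, h6, h4, ⟨by simp [remaining], by simp [h5], ?_⟩, ?_⟩
  · intro k _
    have : 0 < κ * min 1 (remaining T κ k) := mul_pos h6 (lt_min one_pos (hpos k))
    simp only [remaining]
    linarith
  · intro k _
    simp only [remaining, sub_sub_cancel]
    ring

end DiscreteDiffusion
end

/-! ### The three claims with a common constant -/

open DiscreteDiffusion in
theorem theorem3 :
    ∃ C : ℝ, 0 < C ∧
      -- early stopping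
      (∀ (d S : ℕ) (q₀ : State d S → ℝ) (δ : ℝ), 0 < d → 0 < S → IsPMF q₀ → 0 < δ →
        TV q₀ (fwdLaw q₀ δ) ≤ C * (d * δ)) ∧
      -- KL bound for arbitrary admissible step sizes
      (∀ (d S N : ℕ) (T δ κ M εscore : ℝ) (t : ℕ → ℝ) (q₀ : State d S → ℝ)
          (s : ℝ → State d S → State d S → ℝ),
        0 < d → 0 < S → IsPMF q₀ → 0 < δ → δ < T → 0 < κ → 1 ≤ M →
        IsGrid T δ N t →
        (∀ k < N, t (k + 1) - t k ≤ κ * min 1 (T - t k)) →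
        ScoreError q₀ T N t s εscore →
        ScoreBounded T N t s M →
        (κ * M ≤ 1 / 2 →
          SamplesWithin (eulerStep T t s) N (fwdLaw q₀ δ)
            (C * (d * Real.log S * Real.exp (-T) + εscore
              + κ * d ^ 2 * S * (T + Real.log (M * S * δ⁻¹))))) ∧
        (κ * M ^ 2 ≤ 1 / 2 →
          SamplesWithin (tweedieStep T t s) N (fwdLaw q₀ δ)
            (C * (d * Real.log S * Real.exp (-T) + εscore
              + κ * d ^ 2 * S * (T + Real.log (M * S * δ⁻¹)))))) ∧
      -- number of steps
      (∀ (d S N : ℕ) (T δ M ε : ℝ),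
        0 < d → 0 < S → 0 < δ → 1 ≤ M → 0 < ε →
        T = Real.log (d * Real.log S / ε) → δ < T →
        C * (d ^ 2 * S / ε) * (T + Real.log (M * S * δ⁻¹)) ^ 2 ≤ N →
        ∃ (κ : ℝ) (t : ℕ → ℝ), 0 < κ ∧ IsGrid T δ N t ∧
          (∀ k < N, t (k + 1) - t k = κ * min 1 (T - t k)) ∧
          ∀ (εscore : ℝ) (q₀ : State d S → ℝ) (s : ℝ → State d S → State d S → ℝ),
            IsPMF q₀ →
            ScoreError q₀ T N t s εscore →
            ScoreBounded T N t s M →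
            (ε * M ≤ d ^ 2 * S →
              SamplesWithin (eulerStep T t s) N (fwdLaw q₀ δ) (C * (ε + εscore))) ∧
            (ε * M ^ 2 ≤ d ^ 2 * S →
              SamplesWithin (tweedieStep T t s) N (fwdLaw q₀ δ) (C * (ε + εscore)))) := by
  -- Twice 1220: in the last claim the initialization and the discretization error together are at
  -- most 2ε.
  refine ⟨2440, by norm_num, ?_, ?_, ?_⟩
  · intro d S q₀ δ _ _ hq hδ
    have h1 := TV_fwdLaw_le hq hδ
    have h2 : 0 ≤ (d : ℝ) * δ := by positivity
    linarith
  · intro d S N T δ κ M ε t q₀ s hd hS hq hδ hδT hκ0 hM ht hκ hε hs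
    have hε0 := hε.nonneg hq hδ hM ht hs
    have hL := (time_add_log_bounds hS hδ hδT hM).1
    have hnonneg : 0 ≤ d * Real.log S * Real.exp (-T) + ε
        + κ * d ^ 2 * S * (T + Real.log (M * S * δ⁻¹)) := by
      have h1 : 0 ≤ Real.log S := Real.log_natCast_nonneg S
      have h2 : 0 ≤ T + Real.log (M * S * δ⁻¹) := by linarith
      positivity
    exact ⟨fun h => (samplesWithin_euler hq hd hS hδ hδT hM hκ0 ht hκ hε hs h).mono (by linarith),
      fun h => (samplesWithin_tweedie hq hd hS hδ hδT hM hκ0 ht hκ hε hs h).mono (by linarith)⟩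
  · intro d S N T δ M ε hd hS hδ hM hε hT hδT hN
    obtain ⟨hL, -, -, hL'⟩ := time_add_log_bounds hS hδ hδT hM
    set L := T + Real.log (M * S * δ⁻¹)
    have hd' : (1 : ℝ) ≤ d := by exact_mod_cast hd
    have hS' : (1 : ℝ) ≤ S := by exact_mod_cast hS
    have hlogS : Real.log S ≤ S := (Real.log_le_sub_one_of_pos (by linarith)).trans (by linarith)
    have hpos : 0 < d * Real.log S / ε := by
      have h0 : 0 ≤ d * Real.log S / ε := by
        have := Real.log_natCast_nonneg S
        positivity
      refine h0.lt_of_ne fun h => ?_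
      -- If d log S = 0, the convention log 0 = 0 would give T = 0, contrary to 0 < δ < T.
      rw [← h, Real.log_zero] at hT
      linarith
    have hexp : d * Real.log S * Real.exp (-T) = ε := by
      rw [hT, Real.exp_neg, Real.exp_log hpos]
      have : d * Real.log S ≠ 0 := fun h => by simp [h] at hpos
      rw [inv_div, mul_div_cancel₀ _ this]
    have hX1 : 1 ≤ d ^ 2 * S / ε := by
      have h1 : 1 ≤ d * Real.log S / ε := by
        rw [← Real.exp_log hpos, ← hT]
        exact Real.one_le_exp (by linarith)
      refine h1.trans (div_le_div_of_nonneg_right ?_ hε.le)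
      have h2 : (d : ℝ) ≤ d ^ 2 := by nlinarith
      exact mul_le_mul h2 hlogS (Real.log_natCast_nonneg S) (by positivity)
    set X : ℝ := d ^ 2 * S / ε with hX
    have hNpos : (0 : ℝ) < N := lt_of_lt_of_le (by positivity) hN
    have hXL : 1 ≤ X * L := by nlinarith
    -- The choice κ₁ = L/N is large enough to reach δ in `N` steps, since N κ₁ = L ≥ T - log δ, and
    -- small enough by the lower bound on `N`.
    have hmain : L / N * (X * L) ≤ 1 / 2440 := by
      rw [div_mul_eq_mul_div, div_le_iff₀ hNpos]
      linarith
    have hκ1 : L / N < 1 := by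
      have : 0 ≤ L / N := by positivity
      nlinarith
    obtain ⟨κ, t, hκ0, hκle, ht, hstep⟩ := exists_grid (N := N) hδ hδT
      (by positivity : 0 ≤ L / N) hκ1 (by rw [mul_div_cancel₀ _ hNpos.ne']; exact hL')
    have hκX : κ * (X * L) ≤ 1 / 2440 :=
      (mul_le_mul_of_nonneg_right hκle (by linarith)).trans hmain
    have hκε : κ * d ^ 2 * S * L ≤ ε / 2440 := by
      have h1 : κ * d ^ 2 * S * L = ε * (κ * (X * L)) := by
        rw [hX]
        field_simp
      rw [h1]
      nlinarith
    have hκM : ∀ B : ℝ, ε * B ≤ d ^ 2 * S → κ * B ≤ 1 / 2 := by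
      intro B hB
      have h1 : B ≤ X := by
        rw [hX, le_div_iff₀ hε]
        linarith
      have h2 : X ≤ X * L := le_mul_of_one_le_right (by linarith) hL
      have h3 : κ * B ≤ κ * (X * L) := mul_le_mul_of_nonneg_left (h1.trans h2) hκ0.le
      linarith
    refine ⟨κ, t, hκ0, ht, hstep, fun εscore q₀ s hq hεs hs => ?_⟩
    have hε0 := hεs.nonneg hq hδ hM ht hs
    have hle : 1220 * (d * Real.log S * Real.exp (-T) + εscore + κ * d ^ 2 * S * L) ≤
        2440 * (ε + εscore) := by
      rw [hexp]
      linarith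
    exact ⟨fun h => (samplesWithin_euler hq hd hS hδ hδT hM hκ0 ht (fun k hk => (hstep k hk).le)
        hεs hs (hκM M h)).mono hle,
      fun h => (samplesWithin_tweedie hq hd hS hδ hδT hM hκ0 ht (fun k hk => (hstep k hk).le)
        hεs hs (hκM (M ^ 2) h)).mono hle⟩
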